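/- Let $d\ge 1$. For a linear map $\mathbf S$ from $n\times n$ to $m\times m$ complex matrices let $\|\mathbf S\|_\diamond=\max_{\|X\|_1=1}\|(\mathbf S\otimes\mathbf 1)(X)\|_1$ be its diamond norm, where $\|\cdot\|_1$ is the trace norm and $X$ ranges over operators on $\mathbb C^n\otimes\mathbb C^n$. For a unitary matrix $U$ let $\mathcal P_U$ be the von Neumann measurement given by the tuple of projectors $|\psi_i\rangle\langle\psi_i|$, where $|\psi_i\rangle=U|i\rangle$, identified with the channel $\sigma\mapsto\sum_i\operatorname{tr}(|\psi_i\rangle\langle\psi_i|\sigma)\,|i\rangle\langle i|$; thus $\mathcal P_{\mathbf 1}$ is the measurement in the standard basis of the space under consideration. The measurement $\mathcal P_{U^{\otimes N}}$ on $(\mathbb C^d)^{\otimes N}$ describes $N$ parallel queries to $\mathcal P_U$. Let $\Theta(U)$ be the angle of the shortest arc of the unit circle containing the spectrum of $U$, and let $\Upsilon(U)=\min_E\Theta(UE)$, the minimum being over all diagonal unitary $d\times d$ matrices $E$. Two channels are called perfectly discriminable (with the assistance of entanglement) if there are a finite-dimensional ancilla, a state $\sigma$ of the system and the ancilla, and a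 two-outcome measurement that tells the two output states of $\sigma$ apart with certainty. For every unitary $d\times d$ matrix $U$ the shortest arc in the definition of $\Theta(U)$ and the minimum defining $\Upsilon(U)$ exist, and for every $N\in\mathbb N$ (including $N=0$) the maximum defining $\|\mathcal P_{U^{\otimes N}}-\mathcal P_{\mathbf 1}\|_\diamond$ is attained, and: (i) if $N\,\Upsilon(U)\ge\pi$, then $\|\mathcal P_{U^{\otimes N}}-\mathcal P_{\mathbf 1}\|_\diamond=2$, and $\mathcal P_{U^{\otimes N}}$ and $\mathcal P_{\mathbf 1}$ are perfectly discriminable; (ii) if $N\,\Upsilon(U)<\pi$, then $\|\mathcal P_{U^{\otimes N}}-\mathcal P_{\mathbf 1}\|_\diamond=2\sin\!\left(\tfrac N2\,\Upsilon(U)\right)$. Consequently, any two distinct von Neumann measurements can be discriminated perfectly with finitely many queries: if $U,V$ are unitary $d\times d$ matrices with $\mathcal P_U\ne\mathcal P_V$, then there is a finite $N$ such that $\|\mathcal P_{U^{\otimes N}}-\mathcal P_{V^{\otimes N}}\|_\diamond=2$ and $\mathcal P_{U^{\otimes N}}$ and $\mathcal P_{V^{\otimes N}}$ are perfectly discriminable.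 -/

import Mathlib

open scoped Matrix ComplexOrder

namespace VonNeumannDiscrimination

noncomputable section

/-- The trace norm `‖X‖₁ = Tr √(Xᴴ X)`: the sum of the singular values of `X`, i.e. of the square
roots of the eigenvalues (with multiplicity) of `Xᴴ X`. -/
def traceNorm {n : Type*} [Fintype n] [DecidableEq n] (X : Matrix n n ℂ) : ℝ :=
  ∑ i, Real.sqrt ((Matrix.isHermitian_conjTranspose_mul_self X).eigenvalues i)

/-- The action of `S ⊗ 1` (identity on `k × k` matrices) on matrices over `ℂⁿ ⊗ ℂᵏ`: `S` is
applied to each block `X_{ab} = (1 ⊗ ⟨a|) X (1 ⊗ |b⟩)`. -/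
def ampliation {n m : Type*} (S : Matrix n n ℂ →ₗ[ℂ] Matrix m m ℂ) (k : Type*)
    (X : Matrix (n × k) (n × k) ℂ) : Matrix (m × k) (m × k) ℂ :=
  Matrix.of fun p q => S (Matrix.of fun i j => X (i, p.2) (j, q.2)) p.1 q.1

/-- The set of all `‖(S ⊗ 1)(X)‖₁` with `‖X‖₁ = 1`, the ancilla being a copy of the input
space of `S`. -/
def diamondValues {n m : Type*} [Fintype n] [DecidableEq n] [Fintype m] [DecidableEq m]
    (S : Matrix n n ℂ →ₗ[ℂ] Matrix m m ℂ) : Set ℝ :=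
  {t | ∃ X : Matrix (n × n) (n × n) ℂ, traceNorm X = 1 ∧ t = traceNorm (ampliation S n X)}

/-- The diamond norm `‖S‖_⋄ = max_{‖X‖₁ = 1} ‖(S ⊗ 1)(X)‖₁`. -/
def diamondNorm {n m : Type*} [Fintype n] [DecidableEq n] [Fintype m] [DecidableEq m]
    (S : Matrix n n ℂ →ₗ[ℂ] Matrix m m ℂ) : ℝ :=
  sSup (diamondValues S)

/-- The measure-and-prepare channel `σ ↦ ∑ i, Tr (M i σ) |i⟩⟨i|` of a measurement `M`. -/
def measurementChannel {n ι : Type*} [Fintype n] [DecidableEq ι]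
    (M : ι → Matrix n n ℂ) : Matrix n n ℂ →ₗ[ℂ] Matrix ι ι ℂ where
  toFun σ := Matrix.diagonal fun i => (M i * σ).trace
  map_add' σ τ := by
    ext i j
    by_cases h : i = j
    · subst h; simp [Matrix.mul_add]
    · simp [h]
  map_smul' c σ := by
    ext i j
    by_cases h : i = j
    · subst h; simp
    · simp [h]

/-- The tuple of projectors `|ψᵢ⟩⟨ψᵢ|`, where `ψᵢ = U |i⟩` is the `i`-th column of `U`. -/
def vonNeumannProjectors {n : Type*} (U : Matrix n n ℂ) : n → Matrix n n ℂ :=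
  fun i => Matrix.vecMulVec (fun a => U a i) (fun a => star (U a i))

/-- The von Neumann measurement `P_U` in the basis `U |i⟩`, as a channel. -/
def vonNeumannChannel {n : Type*} [Fintype n] [DecidableEq n] (U : Matrix n n ℂ) :
    Matrix n n ℂ →ₗ[ℂ] Matrix n n ℂ :=
  measurementChannel (vonNeumannProjectors U)

/-- The tensor power `U^{⊗ N}`, acting on `(ℂⁿ)^{⊗ N}` with basis indexed by `Fin N → n`. -/
def tensorPow {n : Type*} (U : Matrix n n ℂ) (N : ℕ) :
    Matrix (Fin N → n) (Fin N → n) ℂ :=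
  Matrix.of fun i j => ∏ k, U (i k) (j k)

/-- Lengths `θ ≥ 0` of the arcs `{exp (i (α + t)) : 0 ≤ t ≤ θ}` of the unit circle that contain
the spectrum of `U`. -/
def coveringArcLengths {n : Type*} [Fintype n] [DecidableEq n] (U : Matrix n n ℂ) : Set ℝ :=
  {θ | 0 ≤ θ ∧ ∃ α : ℝ, ∀ z ∈ spectrum ℂ U,
    ∃ t ∈ Set.Icc 0 θ, z = Complex.exp (((α + t : ℝ) : ℂ) * Complex.I)}

/-- `Θ(U)`: the angle of the shortest arc containing the spectrum of `U`. -/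
def arcAngle {n : Type*} [Fintype n] [DecidableEq n] (U : Matrix n n ℂ) : ℝ :=
  sInf (coveringArcLengths U)

/-- The diagonal unitary matrices. -/
def diagonalUnitaries (n : Type*) [Fintype n] [DecidableEq n] : Set (Matrix n n ℂ) :=
  {E | E ∈ Matrix.unitaryGroup n ℂ ∧ E.IsDiag}

/-- `Υ(U)`: the minimum of `Θ(U E)` over diagonal unitary matrices `E`. -/
def optimalArcAngle {n : Type*} [Fintype n] [DecidableEq n] (U : Matrix n n ℂ) : ℝ :=
  sInf ((fun E => arcAngle (U * E)) '' diagonalUnitaries n)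

/-- Entanglement-assisted perfect discrimination of two channels in a single use: for some state
`σ` of the system and a finite-dimensional ancilla, a two-outcome measurement `(M, 1 - M)` tells
the two output states apart without error. -/
def PerfectlyDiscriminable {n m : Type*} [Fintype n] [Fintype m] [DecidableEq m]
    (Φ Ψ : Matrix n n ℂ →ₗ[ℂ] Matrix m m ℂ) : Prop :=
  ∃ (k : ℕ) (σ : Matrix (n × Fin k) (n × Fin k) ℂ) (M : Matrix (m × Fin k) (m × Fin k) ℂ),
    σ.PosSemidef ∧ σ.trace = 1 ∧ M.PosSemidef ∧ (1 - M).PosSemidef ∧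
    (M * ampliation Φ (Fin k) σ).trace = 1 ∧ (M * ampliation Ψ (Fin k) σ).trace = 0

end

end VonNeumannDiscrimination

/-!
# Parallel discrimination of von Neumann measurements

With an ancilla, the channel of the measurement `P_U` rotates by `Uᴴ` and then keeps the diagonal
blocks (`ampliation_vonNeumannChannel`). Since the trace norm is dual to the operator norm
(`norm_trace_mul_le`, `exists_norm_le_one_trace_mul_eq`), the diamond distance of `P_U` and `P_V`
is governed by the operators `U D Uᴴ - V D Vᴴ`, where `D` is a block-diagonal contraction
(`trace_ampliation_sub_mul`).

*Upper bound.* The diamond distance is always at most `2`. For `V = 1` the operator is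
`[W, D] Wᴴ = [W - c, D] Wᴴ` for every scalar `c`, and `W = U E` may carry arbitrary diagonal phases
`E`, because they do not change the measurement. If the spectrum of `W` lies in an arc of angle
`Υ`, that of `W^{⊗ N}` lies in an arc of angle `N Υ`; when this is at most `π`, the midpoint `c` of
the chord gives `‖W^{⊗ N} - c‖ ≤ sin (N Υ / 2)` (`norm_tensorPow_sub_cos_le`), hence the bound
`2 sin (N Υ / 2)`.

*Optimality condition.* Let `0 < 2 a ≤ Υ(U)` and `a ≤ π / 2`. Then there are positive semidefinite
`ρ₁`, `ρ₂`, not both zero, such that `exp (-i a) ρ₁ U` and `exp (i a) ρ₂ U` have the same diagonal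
(`exists_balanced_statePair`). Otherwise a separating hyperplane provides a diagonal matrix `D`
such that all the values `⟨v| U D |v⟩` lie in the open cone of half-angle `a` around the positive
axis; the phases `E = D / |D|` then put the spectrum of `U E` into an arc shorter than `2 a`
(`optimalArcAngle_lt_of_cone`).

*Attaining the sine.* If `N Υ(U) < π` and `a = Υ(U) / 2 > 0`, then at the optimal phases the pair
is supported on the eigenspaces of `U E` for the two ends of the arc, and `ρ₁`, `ρ₂` have the same
diagonal (`exists_extremal_eigenstates`). Purifications of `ρ₁^{⊗ N}` and `ρ₂^{⊗ N}` are therefore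
exchanged by a block-diagonal contraction, and yield the distance
`|exp (i N Υ) - 1| = 2 sin (N Υ / 2)` of the eigenvalues (`exists_diamondValue_ge`).

*Perfect discrimination.* If `N Υ(U) ≥ π`, take `2 a = min Υ(U) π`. If one of the two states
vanishes, the other one, `ρ`, satisfies `diag (ρ U) = 0`, and `ρ^{⊗ N}` serves. Otherwise the
diagonals of `(ρ₁^{⊗ k} ⊗ ρ₂^{⊗ (N - k)}) U^{⊗ N}`, for `k = 0, …, N`, are proportional to
`exp (2 i a k)`, points that surround the origin, so that a mixture `ρ` has
`diag (ρ U^{⊗ N}) = 0` (`exists_state_diag_mul_tensorPow_eq_zero`). For a purification of such a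
state the two outputs are orthogonal in every block.

Two measurements with different projectors have `Υ(Vᴴ U) > 0`, and the state found for `Vᴴ U` is
rotated by `V^{⊗ N}`.
-/

set_option linter.unusedSectionVars false

namespace VonNeumannDiscrimination

open scoped Matrix.Norms.L2Operator Kronecker
open Matrix

/-! ### The trace norm as the dual of the operator norm -/

section TraceNorm

variable {n m l : Type*} [Fintype n] [DecidableEq n] [Fintype m] [DecidableEq m] [Fintype l]
  [DecidableEq l]

lemma norm_mul_apply_le (B : Matrix l m ℂ) (M : Matrix m n ℂ) (i : l) (j : n) :
    ‖(B * M) i j‖ ≤ ‖B‖ * √(∑ k, ‖M k j‖ ^ 2) := by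
  have h1 := l2_opNorm_mulVec B (WithLp.toLp 2 fun k => M k j)
  rw [EuclideanSpace.norm_eq (WithLp.toLp 2 fun k => M k j)] at h1
  refine le_trans ?_ h1
  have h2 := PiLp.norm_apply_le (WithLp.toLp 2 (B *ᵥ fun k => M k j)) i
  simpa [Matrix.mul_apply, Matrix.mulVec, dotProduct] using h2

lemma conjTranspose_mul_self_diag (M : Matrix m n ℂ) (j : n) :
    (Mᴴ * M) j j = ((∑ k, ‖M k j‖ ^ 2 : ℝ) : ℂ) := by
  simp [Matrix.mul_apply, Complex.conj_mul']

lemma mul_conjTranspose_self_diag (M : Matrix m n ℂ) (j : m) :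
    (M * Mᴴ) j j = ((∑ k, ‖M j k‖ ^ 2 : ℝ) : ℂ) := by
  simp [Matrix.mul_apply, Complex.mul_conj']

lemma norm_le_one_of_mem_unitaryGroup {U : Matrix n n ℂ} (hU : U ∈ unitaryGroup n ℂ) :
    ‖U‖ ≤ 1 := by
  have h := l2_opNorm_conjTranspose_mul_self U
  have h1 : Uᴴ * U = 1 := mem_unitaryGroup_iff'.1 hU
  have h2 : ‖(1 : Matrix n n ℂ)‖ ≤ 1 := by
    rw [← diagonal_one, l2_opNorm_diagonal]
    exact (pi_norm_le_iff_of_nonneg zero_le_one).2 fun i => by simp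
  rw [h1] at h
  nlinarith [norm_nonneg U]

/-- Spectral decomposition of `Yᴴ Y`, whose eigenvalues are the squared singular values of `Y`. -/
lemma exists_unitary_gram_eq_diagonal (Y : Matrix n n ℂ) :
    ∃ Q ∈ unitaryGroup n ℂ, ∃ μ : n → ℝ, (∀ i, 0 ≤ μ i) ∧ traceNorm Y = ∑ i, √(μ i) ∧
      (Y * Q)ᴴ * (Y * Q) = diagonal fun i => (μ i : ℂ) := by
  have hH := isHermitian_conjTranspose_mul_self Y
  refine ⟨hH.eigenvectorUnitary, hH.eigenvectorUnitary.2, hH.eigenvalues,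
    fun i => (posSemidef_conjTranspose_mul_self Y).eigenvalues_nonneg i, rfl, ?_⟩
  have h := hH.conjStarAlgAut_star_eigenvectorUnitary
  rw [Unitary.conjStarAlgAut_star_apply] at h
  rw [conjTranspose_mul, ← Matrix.star_eq_conjTranspose (hH.eigenvectorUnitary : Matrix n n ℂ)]
  simp only [Matrix.mul_assoc] at h ⊢
  exact h

/-- Hölder's inequality between the trace norm and the operator norm. -/
lemma norm_trace_mul_le (Y C : Matrix n n ℂ) : ‖(Y * C).trace‖ ≤ traceNorm Y * ‖C‖ := by
  obtain ⟨Q, hQ, μ, hμ, hY, hd⟩ := exists_unitary_gram_eq_diagonal Y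
  have h1 : (Y * C).trace = ∑ j, ((Qᴴ * C) * (Y * Q)) j j := by
    have : Q * Qᴴ = 1 := mem_unitaryGroup_iff.1 hQ
    change _ = ((Qᴴ * C) * (Y * Q)).trace
    rw [Matrix.trace_mul_comm (Qᴴ * C), Matrix.mul_assoc Y Q,
      ← Matrix.mul_assoc Q, this, Matrix.one_mul, Matrix.trace_mul_comm]
  have hQC : ‖Qᴴ * C‖ ≤ ‖C‖ := by
    refine (l2_opNorm_mul _ _).trans ?_
    rw [l2_opNorm_conjTranspose]
    exact mul_le_of_le_one_left (norm_nonneg _) (norm_le_one_of_mem_unitaryGroup hQ)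
  rw [h1, hY, Finset.sum_mul]
  refine (norm_sum_le _ _).trans (Finset.sum_le_sum fun j _ => ?_)
  refine (norm_mul_apply_le _ _ j j).trans ?_
  have h2 : ∑ k, ‖(Y * Q) k j‖ ^ 2 = μ j := by
    have := conjTranspose_mul_self_diag (Y * Q) j
    rw [hd, diagonal_apply_eq] at this
    exact_mod_cast this.symm
  rw [h2, mul_comm]
  exact mul_le_mul_of_nonneg_left hQC (Real.sqrt_nonneg _)

/-- The dual optimizer: the adjoint of the partial isometry in the polar decomposition of `Y`. -/
lemma exists_norm_le_one_trace_mul_eq (Y : Matrix n n ℂ) :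
    ∃ C : Matrix n n ℂ, ‖C‖ ≤ 1 ∧ (Y * C).trace = (traceNorm Y : ℂ) := by
  obtain ⟨Q, hQ, μ, hμ, hY, hd⟩ := exists_unitary_gram_eq_diagonal Y
  have hQn := norm_le_one_of_mem_unitaryGroup hQ
  -- The inverse is `0` on the zero singular values, which is what makes the map a contraction.
  set s : Matrix n n ℂ := diagonal fun i => (((√(μ i))⁻¹ : ℝ) : ℂ) with hs
  have hss : sᴴ = s := by simp [hs, diagonal_conjTranspose, Pi.star_def]
  have hK : ‖s * (Y * Q)ᴴ‖ ≤ 1 := by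
    have h1 := l2_opNorm_conjTranspose_mul_self (Y * Q * s)
    rw [conjTranspose_mul, hss, Matrix.mul_assoc, ← Matrix.mul_assoc (Y * Q)ᴴ, hd] at h1
    nth_rewrite 1 2 [hs] at h1
    rw [diagonal_mul_diagonal, diagonal_mul_diagonal, l2_opNorm_diagonal] at h1
    rw [← l2_opNorm_conjTranspose, conjTranspose_mul, conjTranspose_conjTranspose, hss]
    have h2 : ‖fun i => (((√(μ i))⁻¹ : ℝ) : ℂ) * (((μ i : ℝ) : ℂ) * (((√(μ i))⁻¹ : ℝ) : ℂ))‖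
        ≤ 1 := by
      refine (pi_norm_le_iff_of_nonneg zero_le_one).2 fun i => ?_
      rw [← Complex.ofReal_mul, ← Complex.ofReal_mul, Complex.norm_real, Real.norm_eq_abs]
      by_cases h0 : √(μ i) = 0
      · simp [h0]
      · have : (√(μ i))⁻¹ * (μ i * (√(μ i))⁻¹) = 1 := by
          nth_rewrite 2 [← Real.mul_self_sqrt (hμ i)]
          field_simp
        simp [this]
    rw [h1] at h2
    nlinarith [norm_nonneg (Y * Q * s)]
  refine ⟨Q * (s * (Y * Q)ᴴ), ?_, ?_⟩
  · exact (l2_opNorm_mul _ _).trans (mul_le_one₀ hQn (norm_nonneg _) hK)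
  · have h1 : (Y * (Q * (s * (Y * Q)ᴴ))).trace = (s * ((Y * Q)ᴴ * (Y * Q))).trace := by
      rw [← Matrix.mul_assoc, Matrix.trace_mul_comm, Matrix.mul_assoc]
    rw [h1, hd, hs, diagonal_mul_diagonal, trace_diagonal, hY, Complex.ofReal_sum]
    refine Finset.sum_congr rfl fun i _ => ?_
    rw [← Complex.ofReal_mul]
    congr 1
    by_cases h0 : √(μ i) = 0
    · simp [h0]
    · nth_rewrite 2 [← Real.mul_self_sqrt (hμ i)]
      field_simp

lemma traceNorm_nonneg (Y : Matrix n n ℂ) : 0 ≤ traceNorm Y :=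
  Finset.sum_nonneg fun _ _ => Real.sqrt_nonneg _

lemma traceNorm_le {Y : Matrix n n ℂ} {r : ℝ}
    (h : ∀ C : Matrix n n ℂ, ‖C‖ ≤ 1 → ‖(Y * C).trace‖ ≤ r) : traceNorm Y ≤ r := by
  obtain ⟨C, hC, hY⟩ := exists_norm_le_one_trace_mul_eq Y
  have := h C hC
  rwa [hY, Complex.norm_real, Real.norm_of_nonneg (traceNorm_nonneg Y)] at this

lemma le_traceNorm {Y C : Matrix n n ℂ} (hC : ‖C‖ ≤ 1) : ‖(Y * C).trace‖ ≤ traceNorm Y :=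
  (norm_trace_mul_le Y C).trans (mul_le_of_le_one_right (traceNorm_nonneg Y) hC)

lemma norm_dotProduct_mulVec_le (C : Matrix n m ℂ) (x : n → ℂ) (y : m → ℂ) :
    ‖star x ⬝ᵥ C *ᵥ y‖ ≤ √(∑ i, ‖x i‖ ^ 2) * (‖C‖ * √(∑ i, ‖y i‖ ^ 2)) := by
  have h := l2_opNorm_mulVec C (WithLp.toLp 2 y)
  have h2 := norm_inner_le_norm (𝕜 := ℂ) (WithLp.toLp 2 x) (WithLp.toLp 2 (C *ᵥ y))
  rw [EuclideanSpace.inner_toLp_toLp, dotProduct_comm] at h2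
  refine h2.trans ?_
  rw [EuclideanSpace.norm_eq (WithLp.toLp 2 x)]
  refine mul_le_mul_of_nonneg_left (h.trans_eq ?_) (Real.sqrt_nonneg _)
  rw [EuclideanSpace.norm_eq (WithLp.toLp 2 y)]

lemma norm_le_of_forall_mulVec {C : Matrix n m ℂ} {r : ℝ} (hr : 0 ≤ r)
    (h : ∀ y : m → ℂ, ∑ i, ‖(C *ᵥ y) i‖ ^ 2 ≤ r ^ 2 * ∑ i, ‖y i‖ ^ 2) : ‖C‖ ≤ r := by
  rw [l2_opNorm_def]
  refine ContinuousLinearMap.opNorm_le_bound _ hr fun y => ?_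
  have := h y.ofLp
  rw [EuclideanSpace.norm_eq, EuclideanSpace.norm_eq]
  refine (Real.sqrt_le_left (by positivity)).2 ?_
  rw [mul_pow, Real.sq_sqrt (by positivity)]
  exact this

lemma sum_norm_mulVec_sq_le (C : Matrix n m ℂ) (y : m → ℂ) :
    ∑ i, ‖(C *ᵥ y) i‖ ^ 2 ≤ ‖C‖ ^ 2 * ∑ i, ‖y i‖ ^ 2 := by
  have h := l2_opNorm_mulVec C (WithLp.toLp 2 y)
  rw [EuclideanSpace.norm_eq, EuclideanSpace.norm_eq] at h
  have := pow_le_pow_left₀ (Real.sqrt_nonneg _) h 2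
  rw [mul_pow, Real.sq_sqrt (by positivity), Real.sq_sqrt (by positivity)] at this
  exact this

lemma norm_vecMulVec_le (x : n → ℂ) (y : m → ℂ) :
    ‖vecMulVec x (star y)‖ ≤ √(∑ i, ‖x i‖ ^ 2) * √(∑ i, ‖y i‖ ^ 2) := by
  refine norm_le_of_forall_mulVec (by positivity) fun z => ?_
  have h1 : ∀ i, (vecMulVec x (star y) *ᵥ z) i = x i * (star y ⬝ᵥ z) := fun i => by
    rw [vecMulVec_mulVec]; simp
  have h2 : ‖star y ⬝ᵥ z‖ ≤ √(∑ i, ‖y i‖ ^ 2) * √(∑ i, ‖z i‖ ^ 2) := by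
    have h := norm_inner_le_norm (𝕜 := ℂ) (WithLp.toLp 2 y) (WithLp.toLp 2 z)
    rwa [EuclideanSpace.inner_toLp_toLp, dotProduct_comm, EuclideanSpace.norm_eq,
      EuclideanSpace.norm_eq] at h
  simp only [h1, norm_mul, mul_pow]
  rw [← Finset.sum_mul, Real.sq_sqrt (by positivity), Real.sq_sqrt (by positivity), mul_assoc]
  refine mul_le_mul_of_nonneg_left ?_ (by positivity)
  have := pow_le_pow_left₀ (norm_nonneg _) h2 2
  rwa [mul_pow, Real.sq_sqrt (by positivity), Real.sq_sqrt (by positivity)] at this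

lemma trace_vecMulVec_mul (x : n → ℂ) (y : n → ℂ) (C : Matrix n n ℂ) :
    (vecMulVec x (star y) * C).trace = star y ⬝ᵥ C *ᵥ x := by
  rw [vecMulVec_mul, trace_vecMulVec, dotProduct_comm, dotProduct_mulVec]

lemma traceNorm_vecMulVec {x y : n → ℂ} (hx : ∑ i, ‖x i‖ ^ 2 = 1) (hy : ∑ i, ‖y i‖ ^ 2 = 1) :
    traceNorm (vecMulVec x (star y)) = 1 := by
  apply le_antisymm
  · refine traceNorm_le fun C hC => ?_
    rw [trace_vecMulVec_mul]
    refine (norm_dotProduct_mulVec_le C y x).trans ?_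
    simpa [hx, hy] using hC
  · have hC : ‖vecMulVec y (star x)‖ ≤ 1 := by simpa [hx, hy] using norm_vecMulVec_le y x
    refine le_trans (le_of_eq ?_) (le_traceNorm hC)
    have h1 : ∀ z : n → ℂ, ∑ i, ‖z i‖ ^ 2 = 1 → star z ⬝ᵥ z = 1 := fun z hz => by
      have : star z ⬝ᵥ z = ((∑ i, ‖z i‖ ^ 2 : ℝ) : ℂ) := by
        simp [dotProduct, Complex.conj_mul']
      rw [this, hz, Complex.ofReal_one]
    rw [trace_vecMulVec_mul, vecMulVec_mulVec, dotProduct_smul, h1 x hx, h1 y hy]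
    simp

open scoped MatrixOrder in
lemma exists_eq_mul_conjTranspose {ρ : Matrix n n ℂ} (h : ρ.PosSemidef) :
    ∃ A : Matrix n n ℂ, ρ = A * Aᴴ := by
  obtain ⟨B, rfl⟩ := CStarAlgebra.nonneg_iff_eq_star_mul_self.mp h.nonneg
  exact ⟨Bᴴ, by rw [conjTranspose_conjTranspose, star_eq_conjTranspose]⟩

end TraceNorm

/-! ### Upper bounds for the diamond distance -/

section Channel

variable {n k : Type*} [Fintype n] [DecidableEq n] [Fintype k] [DecidableEq k]

/-- The block-diagonal part of a matrix on `ℂⁿ ⊗ ℂᵏ`, with respect to the basis of `ℂⁿ`. -/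
def pinch (C : Matrix (n × k) (n × k) ℂ) : Matrix (n × k) (n × k) ℂ :=
  Matrix.of fun p q => if p.1 = q.1 then C p q else 0

lemma norm_pinch_le (C : Matrix (n × k) (n × k) ℂ) : ‖pinch C‖ ≤ ‖C‖ := by
  refine norm_le_of_forall_mulVec (norm_nonneg _) fun y => ?_
  -- Row `i` of blocks of the pinching only sees the block `i` of `y`.
  set Y : n → n × k → ℂ := fun i p => if i = p.1 then y p else 0 with hY
  have h1 : ∀ i a, (pinch C *ᵥ y) (i, a) = (C *ᵥ Y i) (i, a) := fun i a => by
    simp [pinch, mulVec, dotProduct, hY]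
  have h2 : ∀ i, ∑ p, ‖Y i p‖ ^ 2 = ∑ a, ‖y (i, a)‖ ^ 2 := fun i => by
    rw [Fintype.sum_prod_type, Finset.sum_eq_single i]
    · simp [hY]
    · intro j _ hj
      simp [hY, hj.symm]
    · simp
  rw [Fintype.sum_prod_type, Fintype.sum_prod_type (fun p => ‖y p‖ ^ 2), Finset.mul_sum]
  refine Finset.sum_le_sum fun i _ => ?_
  rw [← h2]
  refine le_trans ?_ (sum_norm_mulVec_sq_le C (Y i))
  rw [Fintype.sum_prod_type]
  refine le_trans (le_of_eq ?_) (Finset.single_le_sum (fun j _ => by positivity)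
    (Finset.mem_univ i))
  exact Finset.sum_congr rfl fun a _ => by rw [h1]

lemma norm_kronecker_one_le (A : Matrix n n ℂ) : ‖A ⊗ₖ (1 : Matrix k k ℂ)‖ ≤ ‖A‖ := by
  refine norm_le_of_forall_mulVec (norm_nonneg _) fun y => ?_
  have h1 : ∀ i a, ((A ⊗ₖ (1 : Matrix k k ℂ)) *ᵥ y) (i, a) = (A *ᵥ fun j => y (j, a)) i :=
    fun i a => by
      simp [mulVec, dotProduct, Fintype.sum_prod_type, kroneckerMap_apply, one_apply]
  rw [Fintype.sum_prod_type_right, Fintype.sum_prod_type_right (fun p => ‖y p‖ ^ 2),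
    Finset.mul_sum]
  refine Finset.sum_le_sum fun a _ => ?_
  simp only [h1]
  exact sum_norm_mulVec_sq_le A _

lemma kronecker_one_mem_unitaryGroup {U : Matrix n n ℂ} (hU : U ∈ unitaryGroup n ℂ) :
    U ⊗ₖ (1 : Matrix k k ℂ) ∈ unitaryGroup (n × k) ℂ := by
  rw [mem_unitaryGroup_iff, star_eq_conjTranspose, conjTranspose_kronecker, ← mul_kronecker_mul,
    ← star_eq_conjTranspose, mem_unitaryGroup_iff.1 hU]
  simp

lemma vonNeumannChannel_apply (U Y : Matrix n n ℂ) :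
    vonNeumannChannel U Y = diagonal fun i => (Uᴴ * Y * U) i i := by
  change diagonal _ = _
  congr 1
  funext i
  simp only [vonNeumannProjectors, vecMulVec_mul, trace_vecMulVec, Matrix.mul_apply,
    dotProduct, vecMul, conjTranspose_apply]
  exact Finset.sum_congr rfl fun j _ => mul_comm _ _

lemma vonNeumannChannel_mul_diagonalUnitary (U : Matrix n n ℂ) {E : Matrix n n ℂ}
    (hE : E ∈ diagonalUnitaries n) : vonNeumannChannel (U * E) = vonNeumannChannel U := by
  obtain ⟨hE1, hE2⟩ := hE
  obtain ⟨e, rfl⟩ : ∃ e, E = diagonal e := ⟨_, hE2.diagonal_diag.symm⟩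
  have he : ∀ i, star (e i) * e i = 1 := fun i => by
    have h := mem_unitaryGroup_iff'.1 hE1
    rw [star_eq_conjTranspose, diagonal_conjTranspose, diagonal_mul_diagonal] at h
    simpa using congrFun (congrFun h i) i
  ext Y i j
  rw [vonNeumannChannel_apply, vonNeumannChannel_apply]
  congr 2
  funext i
  have : (U * diagonal e)ᴴ * Y * (U * diagonal e) =
      diagonal (star e) * (Uᴴ * Y * U) * diagonal e := by
    simp only [conjTranspose_mul, diagonal_conjTranspose, Matrix.mul_assoc]
  rw [this, mul_diagonal, diagonal_mul, mul_right_comm, Pi.star_apply, he i, one_mul]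

/-- A von Neumann measurement, with an ancilla, rotates by `Uᴴ` and then dephases. -/
lemma ampliation_vonNeumannChannel (U : Matrix n n ℂ) (X : Matrix (n × k) (n × k) ℂ) :
    ampliation (vonNeumannChannel U) k X =
      pinch ((U ⊗ₖ (1 : Matrix k k ℂ))ᴴ * X * (U ⊗ₖ (1 : Matrix k k ℂ))) := by
  ext ⟨i, a⟩ ⟨j, b⟩
  simp only [ampliation, pinch, of_apply, vonNeumannChannel_apply, diagonal_apply]
  split_ifs with h
  · subst h
    simp [Matrix.mul_apply, conjTranspose_apply, Fintype.sum_prod_type, kroneckerMap_apply,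
      one_apply, apply_ite (starRingEnd ℂ)]
  · rfl

lemma trace_pinch_mul (Y C : Matrix (n × k) (n × k) ℂ) :
    (pinch Y * C).trace = (Y * pinch C).trace := by
  simp only [Matrix.trace, diag_apply, Matrix.mul_apply, pinch, of_apply, ite_mul, mul_ite,
    zero_mul, mul_zero]
  refine Finset.sum_congr rfl fun p _ => Finset.sum_congr rfl fun q _ => ?_
  simp only [eq_comm]

lemma ampliation_sub {m : Type*} (S T : Matrix n n ℂ →ₗ[ℂ] Matrix m m ℂ)
    (X : Matrix (n × k) (n × k) ℂ) :
    ampliation (S - T) k X = ampliation S k X - ampliation T k X := by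
  ext p q
  simp [ampliation]

/-- The dual form of the output difference: a test operator `C` enters only through its
block-diagonal part. -/
lemma trace_ampliation_sub_mul (U V : Matrix n n ℂ) (X C : Matrix (n × k) (n × k) ℂ) :
    (ampliation (vonNeumannChannel U - vonNeumannChannel V) k X * C).trace =
      (X * ((U ⊗ₖ (1 : Matrix k k ℂ)) * pinch C * (U ⊗ₖ (1 : Matrix k k ℂ))ᴴ -
        (V ⊗ₖ (1 : Matrix k k ℂ)) * pinch C * (V ⊗ₖ (1 : Matrix k k ℂ))ᴴ)).trace := by
  have h : ∀ W : Matrix (n × k) (n × k) ℂ, (pinch (Wᴴ * X * W) * C).trace =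
      (X * (W * pinch C * Wᴴ)).trace := fun W => by
    rw [trace_pinch_mul, Matrix.mul_assoc, Matrix.mul_assoc, Matrix.trace_mul_comm,
      Matrix.mul_assoc]
  rw [ampliation_sub, Matrix.sub_mul, trace_sub, ampliation_vonNeumannChannel,
    ampliation_vonNeumannChannel, h, h, Matrix.mul_sub, trace_sub]

lemma norm_conj_le {W D : Matrix n n ℂ} (hW : W ∈ unitaryGroup n ℂ) (hD : ‖D‖ ≤ 1) :
    ‖W * D * Wᴴ‖ ≤ 1 := by
  have hW1 := norm_le_one_of_mem_unitaryGroup hW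
  refine (l2_opNorm_mul _ _).trans (mul_le_one₀ ((l2_opNorm_mul _ _).trans
    (mul_le_one₀ hW1 (norm_nonneg _) hD)) (norm_nonneg _) ?_)
  rwa [l2_opNorm_conjTranspose]

lemma traceNorm_ampliation_sub_le_two {U V : Matrix n n ℂ} (hU : U ∈ unitaryGroup n ℂ)
    (hV : V ∈ unitaryGroup n ℂ) (X : Matrix (n × k) (n × k) ℂ) :
    traceNorm (ampliation (vonNeumannChannel U - vonNeumannChannel V) k X) ≤
      2 * traceNorm X := by
  refine traceNorm_le fun C hC => ?_
  rw [trace_ampliation_sub_mul, mul_comm]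
  refine (norm_trace_mul_le _ _).trans (mul_le_mul_of_nonneg_left ?_ (traceNorm_nonneg X))
  have hp := (norm_pinch_le C).trans hC
  refine (norm_sub_le _ _).trans ?_
  linarith [norm_conj_le (kronecker_one_mem_unitaryGroup (k := k) hU) hp,
    norm_conj_le (kronecker_one_mem_unitaryGroup (k := k) hV) hp]

/-- If `W` lies within distance `r` of a scalar `c`, the commutator of `W` with a contraction is
that of `W - c`, hence has norm at most `2 r`. -/
lemma traceNorm_ampliation_sub_one_le {W : Matrix n n ℂ} (hW : W ∈ unitaryGroup n ℂ) (c : ℂ)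
    (X : Matrix (n × k) (n × k) ℂ) :
    traceNorm (ampliation (vonNeumannChannel W - vonNeumannChannel 1) k X) ≤
      2 * ‖W - c • 1‖ * traceNorm X := by
  refine traceNorm_le fun C hC => ?_
  rw [trace_ampliation_sub_mul, mul_comm]
  refine (norm_trace_mul_le _ _).trans (mul_le_mul_of_nonneg_left ?_ (traceNorm_nonneg X))
  have hp := (norm_pinch_le C).trans hC
  set D := pinch C
  have hwu := kronecker_one_mem_unitaryGroup (k := k) hW
  have hw : ‖W ⊗ₖ (1 : Matrix k k ℂ) - c • 1‖ ≤ ‖W - c • 1‖ := by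
    have : W ⊗ₖ (1 : Matrix k k ℂ) - c • 1 = (W - c • 1) ⊗ₖ (1 : Matrix k k ℂ) := by
      rw [sub_eq_add_neg, sub_eq_add_neg, add_kronecker, ← neg_smul, ← neg_smul, smul_kronecker,
        one_kronecker_one]
    rw [this]
    exact norm_kronecker_one_le _
  set w := W ⊗ₖ (1 : Matrix k k ℂ)
  have hww : w * wᴴ = 1 := mem_unitaryGroup_iff.1 hwu
  have key : w * D * wᴴ - (1 ⊗ₖ (1 : Matrix k k ℂ)) * D * (1 ⊗ₖ (1 : Matrix k k ℂ))ᴴ =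
      ((w - c • 1) * D - D * (w - c • 1)) * wᴴ := by
    simp only [one_kronecker_one, conjTranspose_one, Matrix.one_mul, Matrix.mul_one,
      Matrix.sub_mul, Matrix.mul_sub, Matrix.smul_mul, Matrix.mul_smul]
    rw [Matrix.mul_assoc D w, hww, Matrix.mul_one]
    abel
  rw [key]
  have hr := norm_nonneg (w - c • 1)
  have h1 : ‖(w - c • 1) * D‖ ≤ ‖w - c • 1‖ :=
    (l2_opNorm_mul _ _).trans (mul_le_of_le_one_right hr hp)
  have h2 : ‖D * (w - c • 1)‖ ≤ ‖w - c • 1‖ :=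
    (l2_opNorm_mul _ _).trans (mul_le_of_le_one_left hr hp)
  have h3 : ‖wᴴ‖ ≤ 1 := by
    rw [l2_opNorm_conjTranspose]
    exact norm_le_one_of_mem_unitaryGroup hwu
  calc _ ≤ ‖(w - c • 1) * D - D * (w - c • 1)‖ * ‖wᴴ‖ := l2_opNorm_mul _ _
    _ ≤ ‖(w - c • 1) * D - D * (w - c • 1)‖ := mul_le_of_le_one_right (norm_nonneg _) h3
    _ ≤ ‖(w - c • 1) * D‖ + ‖D * (w - c • 1)‖ := norm_sub_le _ _
    _ ≤ 2 * ‖W - c • 1‖ := by linarith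

end Channel

/-! ### Input states attaining the bounds -/

section Attain

variable {n k : Type*} [Fintype n] [DecidableEq n] [Fintype k] [DecidableEq k]

/-- The block-diagonal matrix whose `i`-th block is the outer product of the `i`-th rows of `G`
and `H`. -/
def blockOuter (G H : Matrix n k ℂ) : Matrix (n × k) (n × k) ℂ :=
  Matrix.of fun p q => if p.1 = q.1 then G p.1 p.2 * star (H q.1 q.2) else 0

lemma blockOuter_mul (G H G' H' : Matrix n k ℂ) :
    blockOuter G H * blockOuter G' H' =
      blockOuter (diagonal (fun i => (G' * Hᴴ) i i) * G) H' := by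
  ext ⟨i, a⟩ ⟨j, b⟩
  simp only [blockOuter, of_apply, diagonal_mul]
  simp only [Matrix.mul_apply, of_apply, Fintype.sum_prod_type,
    conjTranspose_apply, ite_mul, mul_ite, zero_mul, mul_zero]
  split_ifs with h
  · subst h
    rw [Finset.sum_eq_single i]
    · simp only [if_true, Finset.sum_mul]
      exact Finset.sum_congr rfl fun x _ => by ring
    · intro x _ hx
      simp [hx.symm]
    · simp
  · refine Finset.sum_eq_zero fun x _ => Finset.sum_eq_zero fun y _ => ?_
    by_cases h1 : i = x
    · subst h1; simp [h]
    · simp [h1]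

lemma trace_blockOuter (G H : Matrix n k ℂ) : (blockOuter G H).trace = (G * Hᴴ).trace := by
  simp [Matrix.trace, blockOuter, Matrix.mul_apply, Fintype.sum_prod_type]

lemma conjTranspose_blockOuter (G H : Matrix n k ℂ) : (blockOuter G H)ᴴ = blockOuter H G := by
  ext p q
  simp only [blockOuter, conjTranspose_apply, of_apply]
  by_cases h : q.1 = p.1
  · simp [h, mul_comm]
  · simp [h, Ne.symm h]

lemma blockOuter_diagonal_mul_right (s : n → ℂ) (G H : Matrix n k ℂ) :
    blockOuter G (diagonal s * H) = blockOuter (diagonal (star s) * G) H := by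
  ext p q
  simp only [blockOuter, of_apply, diagonal_mul, Pi.star_apply]
  split_ifs with h
  · rw [h, star_mul']; ring
  · rfl

lemma blockOuter_smul_smul (x y : ℂ) (G H : Matrix n k ℂ) :
    blockOuter (x • G) (y • H) = (x * star y) • blockOuter G H := by
  ext p q
  simp only [blockOuter, of_apply, Matrix.smul_apply, smul_eq_mul, star_mul']
  split_ifs
  · ring
  · simp

/-- The output of a von Neumann measurement on `|A⟩⟩⟨⟨B|`, where `|A⟩⟩` is the vector in
`ℂⁿ ⊗ ℂᵏ` with coordinates the entries of `A`. -/
lemma ampliation_vonNeumannChannel_vecMulVec (U : Matrix n n ℂ) (A B : Matrix n k ℂ) :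
    ampliation (vonNeumannChannel U) k
      (vecMulVec (fun p : n × k => A p.1 p.2) (star fun p : n × k => B p.1 p.2)) =
      blockOuter (Uᴴ * A) (Uᴴ * B) := by
  ext ⟨i, a⟩ ⟨j, b⟩
  simp only [ampliation, blockOuter, of_apply, vonNeumannChannel_apply, diagonal_apply]
  split_ifs with h
  · subst h
    simp only [Matrix.mul_apply, conjTranspose_apply, of_apply, vecMulVec_apply, Pi.star_apply,
      star_sum, star_mul', star_star, Finset.sum_mul, Finset.mul_sum]
    exact Finset.sum_congr rfl fun x _ => Finset.sum_congr rfl fun y _ => by ring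
  · rfl

/-- The projection onto the rows of `G`, one in each block. Rows that vanish contribute `0`. -/
noncomputable def rowProjection (G : Matrix n k ℂ) : Matrix (n × k) (n × k) ℂ :=
  blockOuter (diagonal (fun i => ((G * Gᴴ) i i)⁻¹) * G) G

lemma rowProjection_mul_self (G : Matrix n k ℂ) :
    rowProjection G * rowProjection G = rowProjection G := by
  rw [rowProjection, blockOuter_mul, ← Matrix.mul_assoc, diagonal_mul_diagonal]
  congr 3
  funext i
  rw [Matrix.mul_assoc, diagonal_mul]
  by_cases h : (G * Gᴴ) i i = 0
  · simp [h]
  · field_simp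

lemma conjTranspose_rowProjection (G : Matrix n k ℂ) :
    (rowProjection G)ᴴ = rowProjection G := by
  rw [rowProjection, conjTranspose_blockOuter, blockOuter_diagonal_mul_right]
  congr 3
  funext i
  rw [Pi.star_apply, mul_conjTranspose_self_diag]
  simp

lemma norm_le_one_of_conjTranspose_mul_self_eq {C P : Matrix n n ℂ} (hC : Cᴴ * C = P)
    (hP : P * P = P) : ‖C‖ ≤ 1 := by
  have hPs : Pᴴ = P := by rw [← hC]; simp
  have h1 := l2_opNorm_conjTranspose_mul_self P
  rw [hPs, hP] at h1
  have h2 := l2_opNorm_conjTranspose_mul_self C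
  rw [hC] at h2
  have h3 : ‖P‖ ≤ 1 := by nlinarith [norm_nonneg P]
  nlinarith [norm_nonneg C]

/-- If all the rows of `Uᴴ A` and `Vᴴ A` are orthogonal, the projection onto the rows of `Uᴴ A`
tells the two measurements apart on the input `|A⟩⟩`. -/
lemma trace_rowProjection_mul {U V : Matrix n n ℂ} {A : Matrix n k ℂ}
    (hU : U ∈ unitaryGroup n ℂ) (hA : (A * Aᴴ).trace = 1)
    (hd : ∀ i, (Vᴴ * (A * Aᴴ) * U) i i = 0) :
    (rowProjection (Uᴴ * A) * blockOuter (Uᴴ * A) (Uᴴ * A)).trace = 1 ∧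
      (rowProjection (Uᴴ * A) * blockOuter (Vᴴ * A) (Vᴴ * A)).trace = 0 := by
  constructor
  · rw [rowProjection, blockOuter_mul, trace_blockOuter, ← Matrix.mul_assoc,
      diagonal_mul_diagonal, Matrix.mul_assoc (diagonal _)]
    have h1 : ((Uᴴ * A) * (Uᴴ * A)ᴴ).trace = 1 := by
      rw [conjTranspose_mul, conjTranspose_conjTranspose, Matrix.trace_mul_comm,
        Matrix.mul_assoc, ← Matrix.mul_assoc U, ← star_eq_conjTranspose U,
        mem_unitaryGroup_iff.1 hU, Matrix.one_mul, Matrix.trace_mul_comm, hA]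
    refine Eq.trans ?_ h1
    simp only [Matrix.trace, diag_apply, diagonal_mul]
    refine Finset.sum_congr rfl fun i _ => ?_
    by_cases h : ((Uᴴ * A) * (Uᴴ * A)ᴴ) i i = 0
    · rw [h]; simp
    · field_simp
  · rw [rowProjection, blockOuter_mul]
    have : (fun i => ((Vᴴ * A) * (Uᴴ * A)ᴴ) i i) = 0 := by
      funext i
      rw [conjTranspose_mul, conjTranspose_conjTranspose, Matrix.mul_assoc, ← Matrix.mul_assoc A,
        ← Matrix.mul_assoc, hd i]
      rfl
    rw [this, trace_blockOuter]
    simp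

lemma sum_norm_sq_eq_one {A : Matrix n k ℂ} (hA : (A * Aᴴ).trace = 1) :
    ∑ p : n × k, ‖A p.1 p.2‖ ^ 2 = 1 := by
  rw [Fintype.sum_prod_type]
  simp only [Matrix.trace, diag_apply, mul_conjTranspose_self_diag] at hA
  exact_mod_cast hA

lemma perfectlyDiscriminable_of_diag_eq_zero {U V ρ : Matrix n n ℂ} (hU : U ∈ unitaryGroup n ℂ)
    (hρ : ρ.PosSemidef) (ht : ρ.trace = 1) (hd : ∀ i, (Vᴴ * ρ * U) i i = 0) :
    PerfectlyDiscriminable (vonNeumannChannel U) (vonNeumannChannel V) := by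
  obtain ⟨B, rfl⟩ := exists_eq_mul_conjTranspose hρ
  set e := Fintype.equivFin n
  set A : Matrix n (Fin (Fintype.card n)) ℂ := B.submatrix id e.symm with hAdef
  have hA : A * Aᴴ = B * Bᴴ := by
    rw [hAdef, conjTranspose_submatrix, submatrix_mul_equiv]
    simp
  rw [← hA] at ht hd
  obtain ⟨h1, h2⟩ := trace_rowProjection_mul hU ht hd
  set P := rowProjection (Uᴴ * A) with hP
  have hPs : Pᴴ = P := conjTranspose_rowProjection _
  have hPP : P * P = P := rowProjection_mul_self _
  refine ⟨_, vecMulVec (fun p => A p.1 p.2) (star fun p => A p.1 p.2), P,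
    posSemidef_vecMulVec_self_star _, ?_, ?_, ?_, ?_, ?_⟩
  · rw [trace_vecMulVec]
    have := sum_norm_sq_eq_one ht
    simp only [dotProduct, Pi.star_apply, Complex.star_def, Complex.mul_conj']
    exact_mod_cast this
  · rw [← hPP]
    nth_rewrite 1 [← hPs]
    exact posSemidef_conjTranspose_mul_self P
  · have : (1 - P)ᴴ * (1 - P) = 1 - P := by
      rw [conjTranspose_sub, conjTranspose_one, hPs, Matrix.sub_mul, Matrix.mul_sub, Matrix.mul_sub,
        hPP]
      simp
    rw [← this]
    exact posSemidef_conjTranspose_mul_self _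
  · rw [ampliation_vonNeumannChannel_vecMulVec, h1]
  · rw [ampliation_vonNeumannChannel_vecMulVec, h2]

lemma isGreatest_diamondValues_two {U V ρ : Matrix n n ℂ} (hU : U ∈ unitaryGroup n ℂ)
    (hV : V ∈ unitaryGroup n ℂ) (hρ : ρ.PosSemidef) (ht : ρ.trace = 1)
    (hd : ∀ i, (Vᴴ * ρ * U) i i = 0) :
    IsGreatest (diamondValues (vonNeumannChannel U - vonNeumannChannel V)) 2 := by
  obtain ⟨A, rfl⟩ := exists_eq_mul_conjTranspose hρ
  have hn := sum_norm_sq_eq_one ht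
  have hX := traceNorm_vecMulVec hn hn
  have hle := traceNorm_ampliation_sub_le_two hU hV
    (vecMulVec (fun p : n × n => A p.1 p.2) (star fun p : n × n => A p.1 p.2))
  refine ⟨⟨_, hX, le_antisymm ?_ (by simpa [hX] using hle)⟩, ?_⟩
  · obtain ⟨h1, h2⟩ := trace_rowProjection_mul hU ht hd
    set P := rowProjection (Uᴴ * A) with hP
    have hPs : Pᴴ = P := conjTranspose_rowProjection _
    have hPP : P * P = P := rowProjection_mul_self _
    have hC : ‖(2 : ℂ) • P - 1‖ ≤ 1 := by
      refine norm_le_one_of_conjTranspose_mul_self_eq (P := 1) ?_ (Matrix.one_mul 1)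
      rw [conjTranspose_sub, conjTranspose_one, conjTranspose_smul, hPs, Matrix.sub_mul,
        Matrix.mul_sub, Matrix.smul_mul, Matrix.mul_smul, hPP]
      simp only [star_ofNat, Matrix.mul_one, Matrix.one_mul]
      module
    have htr : ∀ W ∈ unitaryGroup n ℂ, (blockOuter (Wᴴ * A) (Wᴴ * A)).trace = 1 := fun W hW => by
      rw [trace_blockOuter, conjTranspose_mul, conjTranspose_conjTranspose,
        Matrix.trace_mul_comm, Matrix.mul_assoc, ← Matrix.mul_assoc W,
        ← star_eq_conjTranspose W, mem_unitaryGroup_iff.1 hW, Matrix.one_mul,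
        Matrix.trace_mul_comm, ht]
    refine le_trans (le_of_eq ?_) (le_traceNorm hC)
    rw [ampliation_sub, ampliation_vonNeumannChannel_vecMulVec,
      ampliation_vonNeumannChannel_vecMulVec, Matrix.trace_mul_comm, Matrix.mul_sub, trace_sub,
      Matrix.sub_mul, Matrix.sub_mul, trace_sub, trace_sub, Matrix.smul_mul, Matrix.smul_mul,
      trace_smul, trace_smul, h1, h2, Matrix.one_mul, Matrix.one_mul, htr U hU, htr V hV]
    norm_num
  · rintro t ⟨X, hX, rfl⟩
    simpa [hX] using traceNorm_ampliation_sub_le_two hU hV X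

/-- Two eigenvectors of `W ⊗ 1` whose reduced states have the same diagonal are exchanged by a
block-diagonal contraction, so the input `|A₁⟩⟩⟨⟨A₂|` reaches the distance of the eigenvalues. -/
lemma exists_diamondValue_ge {W A₁ A₂ : Matrix n n ℂ} {x₁ x₂ : ℂ}
    (h₁ : Wᴴ * A₁ = x₁ • A₁) (h₂ : Wᴴ * A₂ = x₂ • A₂)
    (ht : (A₁ * A₁ᴴ).trace = 1) (hd : ∀ i, (A₁ * A₁ᴴ) i i = (A₂ * A₂ᴴ) i i) :
    ∃ t ∈ diamondValues (vonNeumannChannel W - vonNeumannChannel 1),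
      ‖x₁ * star x₂ - 1‖ ≤ t := by
  have ht2 : (A₂ * A₂ᴴ).trace = 1 := by
    rw [← ht]; exact Finset.sum_congr rfl fun i _ => (hd i).symm
  refine ⟨_, ⟨_, traceNorm_vecMulVec (sum_norm_sq_eq_one ht) (sum_norm_sq_eq_one ht2), rfl⟩, ?_⟩
  set s : n → ℂ := fun i => ((A₁ * A₁ᴴ) i i)⁻¹ with hs
  have hss : star s = s := by
    funext i
    rw [Pi.star_apply, hs]
    simp only [mul_conjTranspose_self_diag]
    simp
  have hC : ‖blockOuter (diagonal s * A₂) A₁‖ ≤ 1 := by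
    refine norm_le_one_of_conjTranspose_mul_self_eq (P := rowProjection A₁) ?_
      (rowProjection_mul_self A₁)
    rw [conjTranspose_blockOuter, blockOuter_mul, rowProjection]
    congr 3
    funext i
    rw [conjTranspose_mul, diagonal_conjTranspose, hss, Matrix.mul_assoc, diagonal_mul,
      ← Matrix.mul_assoc, mul_diagonal, ← hd i, hs]
    by_cases h : (A₁ * A₁ᴴ) i i = 0
    · simp [h]
    · field_simp
  refine le_trans (le_of_eq ?_) (le_traceNorm hC)
  rw [ampliation_sub, ampliation_vonNeumannChannel_vecMulVec,
    ampliation_vonNeumannChannel_vecMulVec, h₁, h₂, blockOuter_smul_smul, conjTranspose_one,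
    Matrix.one_mul, Matrix.one_mul]
  have h4 : (blockOuter A₁ A₂ * blockOuter (diagonal s * A₂) A₁).trace = 1 := by
    rw [blockOuter_mul, trace_blockOuter, ← ht, Matrix.mul_assoc]
    simp only [Matrix.trace, diag_apply, diagonal_mul]
    refine Finset.sum_congr rfl fun i _ => ?_
    rw [Matrix.mul_assoc, diagonal_mul, ← hd i, hs]
    by_cases h : (A₁ * A₁ᴴ) i i = 0
    · simp [h]
    · field_simp
  rw [Matrix.sub_mul, Matrix.smul_mul, trace_sub, trace_smul, h4]
  simp

end Attain

/-! ### Unitary matrices, their spectra, and shortest arcs -/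

section Arc

variable {n : Type*} [Fintype n] [DecidableEq n]

/-- A unitary is `exp (i H)`, where the Hermitian matrix `H` is its argument; diagonalize `H`. -/
lemma exists_unitary_diagonalization {W : Matrix n n ℂ} (hW : W ∈ unitaryGroup n ℂ) :
    ∃ V ∈ unitaryGroup n ℂ, ∃ τ : n → ℝ,
      W = V * diagonal (fun j => Complex.exp (τ j * Complex.I)) * Vᴴ := by
  have hfin : (spectrum ℂ W).Finite := Matrix.finite_spectrum W
  have hc : ∀ f : ℂ → ℂ, ContinuousOn f (spectrum ℂ W) := fun f => hfin.continuousOn f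
  have hWn : IsStarNormal W := by
    constructor
    change star W * W = W * star W
    rw [mem_unitaryGroup_iff.1 hW, mem_unitaryGroup_iff'.1 hW]
  set H : Matrix n n ℂ := cfc (fun z : ℂ => (z.arg : ℂ)) W with hH
  have hHs : H.IsHermitian := by
    change star H = H
    rw [hH, ← cfc_star]
    simp
  have hexp : NormedSpace.exp (Complex.I • H) = W := by
    rw [hH, ← cfc_smul Complex.I _ W (hc _), ← CFC.exp_eq_normedSpace_exp (𝕜 := ℂ),
      ← cfc_comp' _ _ W (Complex.continuous_exp.continuousOn.congr fun x _ => by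
        rw [← Complex.exp_eq_exp_ℂ]) (hc _)]
    conv_rhs => rw [← cfc_id' ℂ W]
    refine cfc_congr fun z hz => ?_
    have hz1 : ‖z‖ = 1 := spectrum.norm_eq_one_of_unitary hW hz
    have : z = Complex.exp (z.arg * Complex.I) := by
      conv_lhs => rw [← Complex.norm_mul_exp_arg_mul_I z, hz1]
      simp
    rw [← Complex.exp_eq_exp_ℂ, smul_eq_mul, mul_comm, ← this]
  refine ⟨hHs.eigenvectorUnitary, hHs.eigenvectorUnitary.2, hHs.eigenvalues, ?_⟩
  have hsp := hHs.spectral_theorem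
  rw [Unitary.conjStarAlgAut_apply] at hsp
  set V : Matrix n n ℂ := (hHs.eigenvectorUnitary : Matrix n n ℂ)
  have hV : V * star V = 1 := mem_unitaryGroup_iff.1 hHs.eigenvectorUnitary.2
  have hinv : V⁻¹ = star V := inv_eq_right_inv hV
  have hVu : IsUnit V := IsUnit.of_mul_eq_one _ hV
  have h1 : Complex.I • H = V * diagonal (fun j => (hHs.eigenvalues j : ℂ) * Complex.I) * V⁻¹ := by
    conv_lhs => rw [hsp]
    rw [hinv, ← Matrix.smul_mul, ← Matrix.mul_smul, ← diagonal_smul]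
    congr 3
    funext j
    simp [mul_comm]
  rw [← hexp, h1, exp_conj _ _ hVu, exp_diagonal, hinv]
  congr 3
  funext j
  rw [Pi.coe_exp, Complex.exp_eq_exp_ℂ]

lemma spectrum_unitary_conj {V : Matrix n n ℂ} (hV : V ∈ unitaryGroup n ℂ) (w : n → ℂ) :
    spectrum ℂ (V * diagonal w * Vᴴ) = Set.range w := by
  rw [← spectrum_diagonal w]
  exact Unitary.spectrum_star_right_conjugate (U := ⟨V, hV⟩)

lemma mem_coveringArcLengths_iff {V : Matrix n n ℂ} (hV : V ∈ unitaryGroup n ℂ) (w : n → ℂ)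
    {θ : ℝ} : θ ∈ coveringArcLengths (V * diagonal w * Vᴴ) ↔ 0 ≤ θ ∧ ∃ α : ℝ, ∀ j,
      ∃ t ∈ Set.Icc 0 θ, w j = Complex.exp (((α + t : ℝ) : ℂ) * Complex.I) := by
  rw [coveringArcLengths, spectrum_unitary_conj hV]
  simp

lemma isCompact_unitaryGroup : IsCompact (unitaryGroup n ℂ : Set (Matrix n n ℂ)) := by
  have : ProperSpace (Matrix n n ℂ) := FiniteDimensional.proper ℂ _
  refine Metric.isCompact_of_isClosed_isBounded isClosed_unitary ?_
  refine (Metric.isBounded_closedBall (x := (0 : Matrix n n ℂ)) (r := 1)).subset fun U hU => ?_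
  simpa using norm_le_one_of_mem_unitaryGroup hU

lemma isCompact_diagonalUnitaries : IsCompact (diagonalUnitaries n) := by
  refine isCompact_unitaryGroup.inter_right (t := {E : Matrix n n ℂ | E.IsDiag}) ?_
  have : {E : Matrix n n ℂ | E.IsDiag} = ⋂ i, ⋂ j, ⋂ (_ : i ≠ j), {E | E i j = 0} := by
    ext E
    simp only [Set.mem_ofPred_eq, Set.mem_iInter]
    exact ⟨fun h i j hij => h hij, fun h i j hij => h i j hij⟩
  rw [this]
  refine isClosed_iInter fun i => isClosed_iInter fun j => isClosed_iInter fun _ => ?_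
  exact isClosed_eq (continuous_id.matrix_elem i j) continuous_const

lemma exp_toIcoMod_mul_I (α s : ℝ) :
    Complex.exp (((toIcoMod Real.two_pi_pos 0 α + s : ℝ) : ℂ) * Complex.I) =
      Complex.exp (((α + s : ℝ) : ℂ) * Complex.I) := by
  rw [toIcoMod, Complex.exp_eq_exp_iff_exists_int]
  refine ⟨-toIcoDiv Real.two_pi_pos 0 α, ?_⟩
  simp only [zsmul_eq_mul]
  push_cast
  ring

lemma two_pi_mem_coveringArcLengths {W : Matrix n n ℂ} (hW : W ∈ unitaryGroup n ℂ) :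
    2 * Real.pi ∈ coveringArcLengths W := by
  obtain ⟨V, hV, τ, rfl⟩ := exists_unitary_diagonalization hW
  refine (mem_coveringArcLengths_iff hV _).2 ⟨Real.two_pi_pos.le, 0, fun j =>
    ⟨toIcoMod Real.two_pi_pos 0 (τ j), ?_, ?_⟩⟩
  · have := toIcoMod_mem_Ico Real.two_pi_pos 0 (τ j)
    exact ⟨this.1, by linarith [this.2]⟩
  · have := exp_toIcoMod_mul_I (τ j) 0
    rw [add_zero, add_zero] at this
    rw [zero_add, this]

/-- Over a compact family of unitaries the shortest covering arc exists: the arcs, together with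
a diagonalization, range over a compact set. -/
lemma exists_isLeast_coveringArcLengths {K : Set (Matrix n n ℂ)} (hK : IsCompact K)
    (hne : K.Nonempty) (hu : K ⊆ unitaryGroup n ℂ) :
    ∃ θ, IsLeast {θ | ∃ W ∈ K, θ ∈ coveringArcLengths W} θ := by
  set F : ℝ × ℝ × (n → ℝ) × Matrix n n ℂ → Matrix n n ℂ := fun p =>
    p.2.2.2 * diagonal (fun j => Complex.exp (((p.2.1 + p.2.2.1 j : ℝ) : ℂ) * Complex.I)) *
      (p.2.2.2)ᴴ with hF
  have hFc : Continuous F := by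
    refine Continuous.matrix_mul (Continuous.matrix_mul (by fun_prop)
      (Continuous.matrix_diagonal (by fun_prop))) (Continuous.matrix_conjTranspose (by fun_prop))
  set T : Set (ℝ × ℝ × (n → ℝ) × Matrix n n ℂ) :=
    (Set.Icc 0 (2 * Real.pi) ×ˢ (Set.Icc 0 (2 * Real.pi) ×ˢ
      ((Set.univ.pi fun _ => Set.Icc 0 (2 * Real.pi)) ×ˢ (unitaryGroup n ℂ : Set _)))) ∩
    ({p | ∀ j, p.2.2.1 j ≤ p.1} ∩ F ⁻¹' K) with hT
  have hTc : IsCompact T := by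
    refine IsCompact.inter_right (isCompact_Icc.prod (isCompact_Icc.prod
      ((isCompact_univ_pi fun _ => isCompact_Icc).prod isCompact_unitaryGroup))) ?_
    refine IsClosed.inter ?_ (hK.isClosed.preimage hFc)
    rw [Set.ofPred_forall]
    exact isClosed_iInter fun j => isClosed_le (by fun_prop) (by fun_prop)
  have hmem : ∀ W ∈ K, ∀ θ ∈ coveringArcLengths W, θ ≤ 2 * Real.pi → θ ∈ Prod.fst '' T := by
    intro W hWK θ hθ hle
    obtain ⟨V, hV, τ, hVW⟩ := exists_unitary_diagonalization (hu hWK)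
    rw [hVW, mem_coveringArcLengths_iff hV] at hθ
    obtain ⟨h0, α, h⟩ := hθ
    choose t ht ht2 using h
    have hα := toIcoMod_mem_Ico Real.two_pi_pos 0 α
    refine ⟨(θ, toIcoMod Real.two_pi_pos 0 α, t, V), ⟨⟨⟨h0, hle⟩, ⟨hα.1, by linarith [hα.2]⟩,
      fun j _ => ⟨(ht j).1, (ht j).2.trans hle⟩, hV⟩, fun j => (ht j).2, ?_⟩, rfl⟩
    change F _ ∈ K
    convert hWK using 1
    rw [hF, hVW]
    simp only [exp_toIcoMod_mul_I, ht2]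
  have hTne : T.Nonempty := by
    obtain ⟨W, hW⟩ := hne
    obtain ⟨p, hp, -⟩ := hmem W hW _ (two_pi_mem_coveringArcLengths (hu hW)) le_rfl
    exact ⟨p, hp⟩
  obtain ⟨θ, hθ⟩ := (hTc.image continuous_fst).exists_isLeast (hTne.image _)
  refine ⟨θ, ?_, ?_⟩
  · obtain ⟨p, ⟨⟨hp1, hp2, hp3, hp4⟩, hp5, hp6⟩, rfl⟩ := hθ.1
    refine ⟨F p, hp6, (mem_coveringArcLengths_iff hp4 _).2 ⟨hp1.1, p.2.1, fun j =>
      ⟨p.2.2.1 j, ⟨(hp3 j trivial).1, hp5 j⟩, rfl⟩⟩⟩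
  · rintro θ' ⟨W, hW, h⟩
    rcases le_total θ' (2 * Real.pi) with hle | hle
    · exact hθ.2 (hmem W hW θ' h hle)
    · refine le_trans ?_ hle
      exact hθ.2 (hmem W hW _ (two_pi_mem_coveringArcLengths (hu hW)) le_rfl)

lemma isLeast_arcAngle {U : Matrix n n ℂ} (hU : U ∈ unitaryGroup n ℂ) :
    IsLeast (coveringArcLengths U) (arcAngle U) := by
  obtain ⟨θ, hθ⟩ := exists_isLeast_coveringArcLengths (K := {U}) isCompact_singleton
    ⟨U, rfl⟩ (by simpa using hU)
  have h : {θ | ∃ W ∈ ({U} : Set (Matrix n n ℂ)), θ ∈ coveringArcLengths W} =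
      coveringArcLengths U := by simp
  rw [h] at hθ
  rw [arcAngle, hθ.csInf_eq]
  exact hθ

lemma isLeast_optimalArcAngle {U : Matrix n n ℂ} (hU : U ∈ unitaryGroup n ℂ) :
    IsLeast ((fun E => arcAngle (U * E)) '' diagonalUnitaries n) (optimalArcAngle U) := by
  obtain ⟨θ, ⟨W, ⟨E, hE, rfl⟩, hθ⟩, hmin⟩ := exists_isLeast_coveringArcLengths
    (K := (fun E => U * E) '' diagonalUnitaries n)
    (isCompact_diagonalUnitaries.image (by fun_prop))
    (Set.Nonempty.image _ ⟨1, one_mem _, isDiag_one⟩)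
    (by rintro _ ⟨E, hE, rfl⟩; exact mul_mem hU hE.1)
  have h : IsLeast ((fun E => arcAngle (U * E)) '' diagonalUnitaries n) θ := by
    constructor
    · have h1 := isLeast_arcAngle (mul_mem hU hE.1)
      exact ⟨E, hE, le_antisymm (h1.2 hθ) (hmin ⟨_, ⟨E, hE, rfl⟩, h1.1⟩)⟩
    · rintro _ ⟨E', hE', rfl⟩
      exact hmin ⟨_, ⟨E', hE', rfl⟩, (isLeast_arcAngle (mul_mem hU hE'.1)).1⟩
  rw [optimalArcAngle, h.csInf_eq]
  exact h

lemma optimalArcAngle_nonneg {U : Matrix n n ℂ} (hU : U ∈ unitaryGroup n ℂ) :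
    0 ≤ optimalArcAngle U := by
  obtain ⟨E, hE, h⟩ := (isLeast_optimalArcAngle hU).1
  rw [← h]
  exact (isLeast_arcAngle (mul_mem hU hE.1)).1.1

/-- If `Υ(U) = 0` then some `U E` is a scalar, so that `U` is diagonal. -/
lemma isDiag_of_optimalArcAngle_eq_zero {U : Matrix n n ℂ} (hU : U ∈ unitaryGroup n ℂ)
    (h0 : optimalArcAngle U = 0) : U.IsDiag := by
  obtain ⟨E, hE, h⟩ := (isLeast_optimalArcAngle hU).1
  have h1 := (isLeast_arcAngle (mul_mem hU hE.1)).1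
  rw [show arcAngle (U * E) = 0 from h.trans h0] at h1
  obtain ⟨V, hV, τ, hVW⟩ := exists_unitary_diagonalization (mul_mem hU hE.1)
  rw [hVW, mem_coveringArcLengths_iff hV] at h1
  obtain ⟨-, α, h2⟩ := h1
  have h3 : (fun j => Complex.exp (τ j * Complex.I)) = fun _ => Complex.exp (α * Complex.I) := by
    funext j
    obtain ⟨t, ht, h3⟩ := h2 j
    rw [h3, le_antisymm ht.2 ht.1, add_zero]
  have h4 : U * E = Complex.exp (α * Complex.I) • 1 := by
    rw [hVW, h3, ← smul_one_eq_diagonal, Matrix.mul_smul, Matrix.mul_one, Matrix.smul_mul,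
      ← star_eq_conjTranspose, mem_unitaryGroup_iff.1 hV]
  have h5 : U = Complex.exp (α * Complex.I) • Eᴴ := by
    rw [← Matrix.mul_one U, ← mem_unitaryGroup_iff.1 hE.1, ← Matrix.mul_assoc, h4,
      Matrix.smul_mul, Matrix.one_mul, star_eq_conjTranspose]
  rw [h5]
  exact (hE.2.conjTranspose).smul _

end Arc

/-! ### Optimality of the diagonal phases, by separation of convex sets -/

section Optimality

variable {n : Type*} [Fintype n] [DecidableEq n]

/-- Pairs of unnormalized states of total trace one. -/
def statePairs (n : Type*) [Fintype n] : Set (Matrix n n ℂ × Matrix n n ℂ) :=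
  {p | p.1.PosSemidef ∧ p.2.PosSemidef ∧ p.1.trace + p.2.trace = 1}

lemma isCompact_statePairs : IsCompact (statePairs n) := by
  -- Write `ρ = A Aᴴ`; the pairs `(A, B)` of total Hilbert-Schmidt norm one form a sphere.
  set F : EuclideanSpace ℂ (Bool × n × n) → Matrix n n ℂ × Matrix n n ℂ := fun x =>
    ((Matrix.of fun i j => x (true, i, j)) * (Matrix.of fun i j => x (true, i, j))ᴴ,
      (Matrix.of fun i j => x (false, i, j)) * (Matrix.of fun i j => x (false, i, j))ᴴ) with hF
  have hFc : Continuous F := by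
    have h : ∀ b : Bool, Continuous fun x : EuclideanSpace ℂ (Bool × n × n) =>
        (Matrix.of fun i j => x (b, i, j) : Matrix n n ℂ) := fun b =>
      continuous_matrix fun i j => by
        simp only [of_apply]
        fun_prop
    exact ((h true).matrix_mul (h true).matrix_conjTranspose).prodMk
      ((h false).matrix_mul (h false).matrix_conjTranspose)
  have htr : ∀ A B : Matrix n n ℂ, (A * Aᴴ).trace + (B * Bᴴ).trace =
      ((∑ i, ∑ j, ‖A i j‖ ^ 2 + ∑ i, ∑ j, ‖B i j‖ ^ 2 : ℝ) : ℂ) := fun A B => by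
    simp only [Matrix.trace, diag_apply, mul_conjTranspose_self_diag]
    push_cast
    rfl
  have : statePairs n = F '' Metric.sphere 0 1 := by
    ext ⟨ρ, σ⟩
    constructor
    · rintro ⟨hρ, hσ, ht⟩
      obtain ⟨A, rfl⟩ := exists_eq_mul_conjTranspose hρ
      obtain ⟨B, rfl⟩ := exists_eq_mul_conjTranspose hσ
      refine ⟨WithLp.toLp 2 fun q => if q.1 then A q.2.1 q.2.2 else B q.2.1 q.2.2, ?_, ?_⟩
      · simp only at ht
        rw [htr] at ht
        rw [mem_sphere_zero_iff_norm, EuclideanSpace.norm_eq, Real.sqrt_eq_one]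
        simp only [Fintype.sum_prod_type, Fintype.sum_bool]
        simpa using (by exact_mod_cast ht : (_ : ℝ) = 1)
      · rw [hF]
        congr 1
    · rintro ⟨x, hx, h⟩
      rw [← h]
      refine ⟨posSemidef_self_mul_conjTranspose _, posSemidef_self_mul_conjTranspose _, ?_⟩
      rw [hF]
      simp only
      rw [htr]
      rw [mem_sphere_zero_iff_norm, EuclideanSpace.norm_eq, Real.sqrt_eq_one] at hx
      simp only [Fintype.sum_prod_type, Fintype.sum_bool] at hx
      simp only [of_apply]
      exact_mod_cast hx
  rw [this]
  exact (isCompact_sphere _ _).image hFc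

lemma convex_statePairs : Convex ℝ (statePairs n) := by
  rintro ⟨ρ, σ⟩ ⟨h1, h2, h3⟩ ⟨ρ', σ'⟩ ⟨h1', h2', h3'⟩ s t hs ht hst
  refine ⟨(h1.smul hs).add (h1'.smul ht), (h2.smul hs).add (h2'.smul ht), ?_⟩
  simp only [Prod.smul_mk, Prod.mk_add_mk, trace_add, trace_smul] at h3 h3' ⊢
  have : s • ρ.trace + t • ρ'.trace + (s • σ.trace + t • σ'.trace) =
      s • (ρ.trace + σ.trace) + t • (ρ'.trace + σ'.trace) := by module
  rw [this, h3, h3', ← add_smul, hst, one_smul]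

/-- A unit complex number in the open cone `|arg z| < a`, described by the two half planes that
bound it. -/
lemma abs_arg_lt_of_sin_pos {a τ : ℝ} (ha : 0 < a) (ha' : a ≤ Real.pi / 2)
    (hτ : τ ∈ Set.Ioc (-Real.pi) Real.pi) (h1 : 0 < Real.sin (a - τ))
    (h2 : 0 < Real.sin (a + τ)) : |τ| < a := by
  have hsa : 0 < Real.sin a := Real.sin_pos_of_pos_of_lt_pi ha (by linarith [Real.pi_pos])
  have hc : 0 < Real.cos τ := by
    rw [Real.sin_sub] at h1
    rw [Real.sin_add] at h2
    by_contra! h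
    nlinarith
  have hτ1 : τ < Real.pi / 2 := by
    by_contra! h
    linarith [Real.cos_nonpos_of_pi_div_two_le_of_le h (by linarith [hτ.2, Real.pi_pos])]
  have hτ2 : -(Real.pi / 2) < τ := by
    by_contra! h
    have := Real.cos_nonpos_of_pi_div_two_le_of_le (x := -τ) (by linarith) (by linarith [hτ.1])
    rw [Real.cos_neg] at this
    linarith
  rw [abs_lt]
  constructor
  · by_contra! h
    linarith [Real.sin_nonpos_of_nonpos_of_neg_pi_le (x := a + τ) (by linarith) (by linarith)]
  · by_contra! h
    linarith [Real.sin_nonpos_of_nonpos_of_neg_pi_le (x := a - τ) (by linarith) (by linarith)]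

/-- If all the values `⟨v| U D |v⟩` lie in the open cone of half-angle `a`, the phases of the
diagonal matrix `D` bring the spectrum of `U` into an arc shorter than `2 a`: for an eigenvector
`x = |D| w` of `U D |D|⁻¹` the eigenvalue is a positive multiple of `⟨w| U D |w⟩`. -/
lemma optimalArcAngle_lt_of_cone [Nonempty n] {U : Matrix n n ℂ} (hU : U ∈ unitaryGroup n ℂ)
    {a : ℝ} (ha : 0 < a) (ha' : a ≤ Real.pi / 2) (D : n → ℂ)
    (h1 : ∀ v : n → ℂ, v ≠ 0 → 0 < (Complex.I * Complex.exp (-a * Complex.I) *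
      (star v ⬝ᵥ U *ᵥ (diagonal D *ᵥ v))).re)
    (h2 : ∀ v : n → ℂ, v ≠ 0 → 0 < (-(Complex.I * Complex.exp (a * Complex.I)) *
      (star v ⬝ᵥ U *ᵥ (diagonal D *ᵥ v))).re) :
    optimalArcAngle U < 2 * a := by
  have hD : ∀ j, D j ≠ 0 := fun j hj => by
    have h := h1 (Pi.single j 1) (by simp)
    have h0 : diagonal D *ᵥ Pi.single j (1 : ℂ) = 0 := by
      rw [diagonal_mulVec_single, hj]
      simp
    rw [h0] at h
    simp at h
  set E : Matrix n n ℂ := diagonal fun j => D j / ‖D j‖ with hE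
  have hEu : E ∈ diagonalUnitaries n := by
    refine ⟨?_, isDiag_diagonal _⟩
    rw [mem_unitaryGroup_iff, star_eq_conjTranspose, hE, diagonal_conjTranspose,
      diagonal_mul_diagonal, ← diagonal_one]
    congr 1
    funext j
    have : (‖D j‖ : ℂ) ≠ 0 := by simpa using hD j
    simp only [Pi.star_apply, star_div₀, Complex.star_def, Complex.conj_ofReal]
    rw [div_mul_div_comm, Complex.mul_conj']
    field_simp
  obtain ⟨V, hV, τ, hVW⟩ := exists_unitary_diagonalization (mul_mem hU hEu.1)
  have hτ : ∀ j, ∃ τ' : ℝ, |τ'| < a ∧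
      Complex.exp (τ j * Complex.I) = Complex.exp (τ' * Complex.I) := by
    intro j
    set z := Complex.exp (τ j * Complex.I) with hz
    have hzn : ‖z‖ = 1 := Complex.norm_exp_ofReal_mul_I _
    have hzarg : z = Complex.exp (z.arg * Complex.I) := by
      conv_lhs => rw [← Complex.norm_mul_exp_arg_mul_I z, hzn]
      simp
    refine ⟨z.arg, ?_, hzarg⟩
    set x : n → ℂ := fun i => V i j with hx
    have hxe : U *ᵥ (E *ᵥ x) = z • x := by
      have h : U * E * V = V * diagonal (fun j => Complex.exp (τ j * Complex.I)) := by
        rw [hVW, Matrix.mul_assoc, ← star_eq_conjTranspose, mem_unitaryGroup_iff'.1 hV,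
          Matrix.mul_one]
      funext i
      have := congrFun (congrFun h i) j
      rw [mul_diagonal] at this
      rw [mulVec_mulVec, Pi.smul_apply, smul_eq_mul, mul_comm, ← this]
      rfl
    have hx0 : ∃ i, x i ≠ 0 := by
      by_contra! h
      have := congrFun (congrFun (mem_unitaryGroup_iff'.1 hV) j) j
      rw [star_eq_conjTranspose, Matrix.mul_apply, one_apply_eq] at this
      simp only [conjTranspose_apply] at this
      rw [Finset.sum_eq_zero fun i _ => by rw [show V i j = 0 from h i, mul_zero]] at this
      exact zero_ne_one this
    set w : n → ℂ := fun i => x i / ‖D i‖ with hw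
    have hw0 : w ≠ 0 := by
      obtain ⟨i, hi⟩ := hx0
      intro h
      have := congrFun h i
      simp [hw, hi, hD i] at this
    have hDw : diagonal D *ᵥ w = E *ᵥ x := by
      funext i
      rw [mulVec_diagonal, hE, mulVec_diagonal, hw]
      ring
    set s : ℝ := ∑ i, ‖x i‖ ^ 2 / ‖D i‖ with hs
    have hs0 : 0 < s := by
      obtain ⟨i, hi⟩ := hx0
      refine Finset.sum_pos' (fun i _ => by positivity) ⟨i, Finset.mem_univ i, ?_⟩
      have := norm_pos_iff.2 hi
      have := norm_pos_iff.2 (hD i)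
      positivity
    have hq : star w ⬝ᵥ U *ᵥ (diagonal D *ᵥ w) = s * Complex.exp (z.arg * Complex.I) := by
      rw [hDw, hxe, dotProduct_smul, smul_eq_mul, ← hzarg, mul_comm]
      congr 1
      rw [hs, dotProduct]
      push_cast
      refine Finset.sum_congr rfl fun i _ => ?_
      rw [hw]
      simp only [Pi.star_apply, star_div₀, Complex.star_def, Complex.conj_ofReal]
      rw [div_mul_eq_mul_div, Complex.conj_mul']
    have p1 := h1 w hw0
    have p2 := h2 w hw0
    rw [hq] at p1 p2
    have e1 : Complex.I * Complex.exp (-a * Complex.I) * (s * Complex.exp (z.arg * Complex.I)) =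
        (s : ℂ) * (Complex.I * Complex.exp ((z.arg - a : ℝ) * Complex.I)) := by
      rw [show ((z.arg - a : ℝ) : ℂ) * Complex.I = -a * Complex.I + z.arg * Complex.I by
        push_cast; ring, Complex.exp_add]
      ring
    have e2 : -(Complex.I * Complex.exp (a * Complex.I)) *
        (s * Complex.exp (z.arg * Complex.I)) =
        (s : ℂ) * (-(Complex.I * Complex.exp ((a + z.arg : ℝ) * Complex.I))) := by
      rw [show ((a + z.arg : ℝ) : ℂ) * Complex.I = a * Complex.I + z.arg * Complex.I by
        push_cast; ring, Complex.exp_add]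
      ring
    rw [e1, Complex.re_ofReal_mul, Complex.I_mul_re, Complex.exp_ofReal_mul_I_im] at p1
    rw [e2, Complex.re_ofReal_mul, Complex.neg_re, Complex.I_mul_re,
      Complex.exp_ofReal_mul_I_im, neg_neg] at p2
    refine abs_arg_lt_of_sin_pos ha ha' (Complex.arg_mem_Ioc z) ?_ (pos_of_mul_pos_right p2 hs0.le)
    rw [← neg_sub, Real.sin_neg]
    exact pos_of_mul_pos_right p1 hs0.le
  choose τ' hτ1 hτ2 using hτ
  obtain ⟨j₀, -, hj₀⟩ := Finset.exists_max_image Finset.univ (fun j => |τ' j|)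
    Finset.univ_nonempty
  have hmem : 2 * |τ' j₀| ∈ coveringArcLengths (U * E) := by
    rw [hVW, mem_coveringArcLengths_iff hV]
    refine ⟨by positivity, -|τ' j₀|, fun j => ⟨τ' j + |τ' j₀|, ?_, ?_⟩⟩
    · have := abs_le.1 (hj₀ j (Finset.mem_univ j))
      constructor <;> linarith [this.1, this.2]
    · rw [hτ2]
      congr 2
      push_cast
      ring
  have l1 := (isLeast_arcAngle (mul_mem hU hEu.1)).2 hmem
  have l2 := (isLeast_optimalArcAngle hU).2 ⟨E, hEu, rfl⟩
  have := hτ1 j₀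
  simp only at l2
  linarith

/-- The optimality condition: if no choice of phases brings the spectrum of `U` into an open arc
of angle `2 a ≤ π`, there is a pair of states on which the two half planes bounding the arc are
in balance. -/
lemma exists_balanced_statePair [Nonempty n] {U : Matrix n n ℂ} (hU : U ∈ unitaryGroup n ℂ)
    {a : ℝ} (ha : 0 < a) (ha' : a ≤ Real.pi / 2) (haU : 2 * a ≤ optimalArcAngle U) :
    ∃ p ∈ statePairs n, ∀ j, Complex.exp (-a * Complex.I) * (p.1 * U) j j =
      Complex.exp (a * Complex.I) * (p.2 * U) j j := by
  set u : ℂ := Complex.I * Complex.exp (-a * Complex.I) with hu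
  set v : ℂ := Complex.I * Complex.exp (a * Complex.I) with hv
  set Φ : (Matrix n n ℂ × Matrix n n ℂ) →ₗ[ℝ] (n → ℂ) :=
    { toFun := fun p j => u * (p.1 * U) j j - v * (p.2 * U) j j
      map_add' := fun p q => by
        funext j
        simp only [Prod.fst_add, Prod.snd_add, Matrix.add_mul, Matrix.add_apply, Pi.add_apply]
        ring
      map_smul' := fun c p => by
        funext j
        simp only [Prod.smul_fst, Prod.smul_snd, Matrix.smul_mul, Matrix.smul_apply,
          Complex.real_smul, Pi.smul_apply, RingHom.id_apply]
        ring } with hΦ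
  have hΦa : ∀ p j, Φ p j = u * (p.1 * U) j j - v * (p.2 * U) j j := fun _ _ => rfl
  have hΦc : Continuous Φ := by
    refine continuous_pi fun j => ?_
    simp only [hΦa]
    have h1 : Continuous fun p : Matrix n n ℂ × Matrix n n ℂ => (p.1 * U) j j :=
      (continuous_fst.matrix_mul continuous_const).matrix_elem j j
    have h2 : Continuous fun p : Matrix n n ℂ × Matrix n n ℂ => (p.2 * U) j j :=
      (continuous_snd.matrix_mul continuous_const).matrix_elem j j
    fun_prop
  by_cases h0 : (0 : n → ℂ) ∈ Φ '' statePairs n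
  · obtain ⟨p, hp, h⟩ := h0
    refine ⟨p, hp, fun j => ?_⟩
    have hj := congrFun h j
    rw [hΦa, Pi.zero_apply, sub_eq_zero, hu, hv, mul_assoc, mul_assoc] at hj
    exact mul_left_cancel₀ Complex.I_ne_zero hj
  exfalso
  obtain ⟨f, c, hf0, hf⟩ := RCLike.geometric_hahn_banach_point_closed (𝕜 := ℂ)
    (convex_statePairs.linear_image Φ) (isCompact_statePairs.image hΦc).isClosed h0
  rw [map_zero, map_zero] at hf0
  set D : n → ℂ := fun j => f (Pi.single j 1) with hD
  have hfD : ∀ z : n → ℂ, f z = ∑ j, z j * D j := fun z => by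
    conv_lhs => rw [← Finset.univ_sum_single z]
    rw [map_sum]
    refine Finset.sum_congr rfl fun j _ => ?_
    rw [hD, ← smul_eq_mul, ← map_smul, ← Pi.single_smul, smul_eq_mul, mul_one]
  have hq : ∀ w : n → ℂ, ∑ j, (vecMulVec w (star w) * U) j j * D j =
      star w ⬝ᵥ U *ᵥ (diagonal D *ᵥ w) := fun w => by
    rw [dotProduct_mulVec]
    refine Finset.sum_congr rfl fun j _ => ?_
    rw [mulVec_diagonal, vecMulVec_mul, vecMulVec_apply]
    ring
  -- Rank one states, normalized, in either component.
  have key : ∀ w : n → ℂ, w ≠ 0 → ∃ r : ℝ, 0 < r ∧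
      (r • vecMulVec w (star w), 0) ∈ statePairs n ∧
      (0, r • vecMulVec w (star w)) ∈ statePairs n := fun w hw => by
    have hs : 0 < ∑ i, ‖w i‖ ^ 2 := by
      obtain ⟨i, hi⟩ := Function.ne_iff.1 hw
      refine Finset.sum_pos' (fun i _ => by positivity) ⟨i, Finset.mem_univ i, ?_⟩
      have := norm_pos_iff.2 hi
      positivity
    have ht : (vecMulVec w (star w)).trace = ((∑ i, ‖w i‖ ^ 2 : ℝ) : ℂ) := by
      simp [trace_vecMulVec, dotProduct, Complex.mul_conj']
    have hp : ((∑ i, ‖w i‖ ^ 2)⁻¹ • vecMulVec w (star w)).PosSemidef :=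
      (posSemidef_vecMulVec_self_star w).smul (inv_pos.2 hs).le
    have ht1 : ((∑ i, ‖w i‖ ^ 2)⁻¹ • vecMulVec w (star w)).trace = 1 := by
      rw [trace_smul, ht, Complex.real_smul, ← Complex.ofReal_mul, inv_mul_cancel₀ hs.ne',
        Complex.ofReal_one]
    exact ⟨_, inv_pos.2 hs, ⟨hp, PosSemidef.zero, by simp [ht1]⟩,
      ⟨PosSemidef.zero, hp, by simp [ht1]⟩⟩
  refine absurd haU (not_le.2 (optimalArcAngle_lt_of_cone hU ha ha' D ?_ ?_))
  · intro w hw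
    obtain ⟨r, hr, hm, -⟩ := key w hw
    have h := hf0.trans (hf _ ⟨_, hm, rfl⟩)
    have e : f (Φ (r • vecMulVec w (star w), 0)) =
        (r : ℂ) * (u * (star w ⬝ᵥ U *ᵥ (diagonal D *ᵥ w))) := by
      rw [hfD, ← hq, Finset.mul_sum, Finset.mul_sum]
      refine Finset.sum_congr rfl fun j _ => ?_
      rw [hΦa]
      simp only [Matrix.smul_mul, Matrix.smul_apply, Complex.real_smul, Matrix.zero_mul,
        Matrix.zero_apply]
      ring
    rw [e] at h
    change 0 < ((r : ℂ) * _).re at h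
    rw [Complex.re_ofReal_mul] at h
    exact pos_of_mul_pos_right h hr.le
  · intro w hw
    obtain ⟨r, hr, -, hm⟩ := key w hw
    have h := hf0.trans (hf _ ⟨_, hm, rfl⟩)
    have e : f (Φ (0, r • vecMulVec w (star w))) =
        (r : ℂ) * (-v * (star w ⬝ᵥ U *ᵥ (diagonal D *ᵥ w))) := by
      rw [hfD, ← hq, Finset.mul_sum, Finset.mul_sum]
      refine Finset.sum_congr rfl fun j _ => ?_
      rw [hΦa]
      simp only [Matrix.smul_mul, Matrix.smul_apply, Complex.real_smul, Matrix.zero_mul,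
        Matrix.zero_apply]
      ring
    rw [e] at h
    change 0 < ((r : ℂ) * _).re at h
    rw [Complex.re_ofReal_mul] at h
    exact pos_of_mul_pos_right h hr.le

end Optimality

section Extremal

variable {n : Type*} [Fintype n] [DecidableEq n]

lemma exists_centered_diagonalization {U : Matrix n n ℂ} (hU : U ∈ unitaryGroup n ℂ) :
    ∃ E ∈ diagonalUnitaries n, ∃ V ∈ unitaryGroup n ℂ, ∃ τ : n → ℝ,
      U * E = V * diagonal (fun j => Complex.exp (τ j * Complex.I)) * Vᴴ ∧
      ∀ j, |τ j| ≤ optimalArcAngle U / 2 := by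
  obtain ⟨E, hE, h⟩ := (isLeast_optimalArcAngle hU).1
  have h1 := (isLeast_arcAngle (mul_mem hU hE.1)).1
  rw [show arcAngle (U * E) = _ from h] at h1
  obtain ⟨V, hV, τ, hVW⟩ := exists_unitary_diagonalization (mul_mem hU hE.1)
  rw [hVW, mem_coveringArcLengths_iff hV] at h1
  obtain ⟨-, α, h2⟩ := h1
  choose t ht ht2 using h2
  set a := optimalArcAngle U / 2 with ha
  -- A global phase moves the middle of the arc to `1`.
  set c : ℂ := Complex.exp ((-(α + a) : ℝ) * Complex.I) with hc
  have hcc : c * star c = 1 := by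
    rw [Complex.star_def, Complex.mul_conj', Complex.norm_exp_ofReal_mul_I]
    norm_num
  refine ⟨c • E, ⟨?_, hE.2.smul c⟩, V, hV, fun j => t j - a, ?_, fun j => ?_⟩
  · rw [mem_unitaryGroup_iff, star_smul, Matrix.smul_mul, Matrix.mul_smul, smul_smul, hcc,
      one_smul]
    exact mem_unitaryGroup_iff.1 hE.1
  · rw [Matrix.mul_smul, hVW, ← Matrix.smul_mul, ← Matrix.mul_smul, ← diagonal_smul]
    congr 3
    funext j
    rw [Pi.smul_apply, smul_eq_mul, ht2, hc, ← Complex.exp_add]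
    congr 1
    push_cast
    ring
  · rw [abs_le]
    have := ht j
    constructor <;> linarith [this.1, this.2]

lemma trace_mul_unitary_conj (A V : Matrix n n ℂ) (w : n → ℂ) :
    (A * Aᴴ * (V * diagonal w * Vᴴ)).trace =
      ∑ j, ((∑ k, ‖(Vᴴ * A) j k‖ ^ 2 : ℝ) : ℂ) * w j := by
  have h : (A * Aᴴ * (V * diagonal w * Vᴴ)).trace =
      ((Vᴴ * A) * (Vᴴ * A)ᴴ * diagonal w).trace := by
    rw [conjTranspose_mul, conjTranspose_conjTranspose, ← Matrix.mul_assoc, Matrix.trace_mul_comm]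
    simp only [Matrix.mul_assoc]
  rw [h]
  simp only [Matrix.trace, diag_apply, mul_diagonal, mul_conjTranspose_self_diag]

lemma conjTranspose_mul_eq_smul {A V : Matrix n n ℂ} (hV : V ∈ unitaryGroup n ℂ) {τ : n → ℝ}
    {b : ℝ} (h : ∀ j, ∑ k, ‖(Vᴴ * A) j k‖ ^ 2 = 0 ∨ τ j = b) :
    (V * diagonal (fun j => Complex.exp (τ j * Complex.I)) * Vᴴ)ᴴ * A =
      Complex.exp (-b * Complex.I) • A := by
  have h1 : (diagonal (fun j => Complex.exp (τ j * Complex.I)))ᴴ * (Vᴴ * A) =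
      Complex.exp (-b * Complex.I) • (Vᴴ * A) := by
    ext j k
    rw [diagonal_conjTranspose, diagonal_mul, Matrix.smul_apply, smul_eq_mul]
    rcases h j with h | h
    · rw [Finset.sum_eq_zero_iff_of_nonneg fun _ _ => by positivity] at h
      have : (Vᴴ * A) j k = 0 := by simpa using h k (Finset.mem_univ k)
      rw [this, mul_zero, mul_zero]
    · rw [Pi.star_apply, Complex.star_def, ← Complex.exp_conj, h]
      simp
  rw [conjTranspose_mul, conjTranspose_mul, conjTranspose_conjTranspose, Matrix.mul_assoc,
    Matrix.mul_assoc, h1, Matrix.mul_smul, ← Matrix.mul_assoc, ← star_eq_conjTranspose,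
    mem_unitaryGroup_iff.1 hV, Matrix.one_mul]

/-- At the optimal phases the balanced pair of states is supported on the eigenspaces of the two
ends of the arc: this is the equality case of the half plane inequalities. The states then have
the same diagonal. -/
lemma exists_extremal_eigenstates [Nonempty n] {U E V : Matrix n n ℂ}
    (hU : U ∈ unitaryGroup n ℂ) (hE : E ∈ diagonalUnitaries n) (hV : V ∈ unitaryGroup n ℂ)
    {τ : n → ℝ} (hW : U * E = V * diagonal (fun j => Complex.exp (τ j * Complex.I)) * Vᴴ)
    {a : ℝ} (ha : 0 < a) (ha' : a < Real.pi / 2) (haU : 2 * a ≤ optimalArcAngle U)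
    (hτ : ∀ j, |τ j| ≤ a) :
    ∃ A₁ A₂ : Matrix n n ℂ, (U * E)ᴴ * A₁ = Complex.exp (-a * Complex.I) • A₁ ∧
      (U * E)ᴴ * A₂ = Complex.exp (a * Complex.I) • A₂ ∧ (A₁ * A₁ᴴ).trace = 1 ∧
      ∀ i, (A₁ * A₁ᴴ) i i = (A₂ * A₂ᴴ) i i := by
  obtain ⟨⟨ρ₁, ρ₂⟩, ⟨hρ₁, hρ₂, ht⟩, hb⟩ := exists_balanced_statePair hU ha ha'.le haU
  simp only at hρ₁ hρ₂ ht hb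
  obtain ⟨A₁, rfl⟩ := exists_eq_mul_conjTranspose hρ₁
  obtain ⟨A₂, rfl⟩ := exists_eq_mul_conjTranspose hρ₂
  have hbE : ∀ j, Complex.exp (-a * Complex.I) * (A₁ * A₁ᴴ * (U * E)) j j =
      Complex.exp (a * Complex.I) * (A₂ * A₂ᴴ * (U * E)) j j := fun j => by
    obtain ⟨e, rfl⟩ : ∃ e, E = diagonal e := ⟨_, hE.2.diagonal_diag.symm⟩
    rw [← Matrix.mul_assoc, ← Matrix.mul_assoc, mul_diagonal, mul_diagonal, ← mul_assoc, hb j,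
      mul_assoc]
  have htr : Complex.exp (-a * Complex.I) * (A₁ * A₁ᴴ * (U * E)).trace =
      Complex.exp (a * Complex.I) * (A₂ * A₂ᴴ * (U * E)).trace := by
    simp only [Matrix.trace, diag_apply, Finset.mul_sum]
    exact Finset.sum_congr rfl fun j _ => hbE j
  set p : n → ℝ := fun j => ∑ k, ‖(Vᴴ * A₁) j k‖ ^ 2 with hp
  set q : n → ℝ := fun j => ∑ k, ‖(Vᴴ * A₂) j k‖ ^ 2 with hq
  have hp0 : ∀ j, 0 ≤ p j := fun j => by rw [hp]; positivity
  have hq0 : ∀ j, 0 ≤ q j := fun j => by rw [hq]; positivity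
  have him : ∑ j, p j * Real.sin (τ j - a) = ∑ j, q j * Real.sin (τ j + a) := by
    have h := congrArg Complex.im htr
    rw [hW, trace_mul_unitary_conj, trace_mul_unitary_conj, Finset.mul_sum, Finset.mul_sum,
      Complex.im_sum, Complex.im_sum] at h
    convert h using 2 with j _ j _
    · rw [mul_left_comm, ← Complex.exp_add, Complex.im_ofReal_mul,
        show -(a : ℂ) * Complex.I + τ j * Complex.I = ((τ j - a : ℝ) : ℂ) * Complex.I by
          push_cast; ring, Complex.exp_ofReal_mul_I_im]
    · rw [mul_left_comm, ← Complex.exp_add, Complex.im_ofReal_mul,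
        show (a : ℂ) * Complex.I + τ j * Complex.I = ((τ j + a : ℝ) : ℂ) * Complex.I by
          push_cast; ring, Complex.exp_ofReal_mul_I_im]
  have hs1 : ∀ j, Real.sin (τ j - a) ≤ 0 := fun j => by
    have := abs_le.1 (hτ j)
    exact Real.sin_nonpos_of_nonpos_of_neg_pi_le (by linarith) (by linarith)
  have hs2 : ∀ j, 0 ≤ Real.sin (τ j + a) := fun j => by
    have := abs_le.1 (hτ j)
    exact Real.sin_nonneg_of_nonneg_of_le_pi (by linarith) (by linarith)
  have hz2 : ∑ j, q j * Real.sin (τ j + a) = 0 := by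
    apply le_antisymm
    · rw [← him]
      exact Finset.sum_nonpos fun j _ => mul_nonpos_of_nonneg_of_nonpos (hp0 j) (hs1 j)
    · exact Finset.sum_nonneg fun j _ => mul_nonneg (hq0 j) (hs2 j)
  have hz1 := him.trans hz2
  rw [Finset.sum_eq_zero_iff_of_nonneg fun j _ => mul_nonneg (hq0 j) (hs2 j)] at hz2
  rw [Finset.sum_eq_zero_iff_of_nonpos fun j _ =>
    mul_nonpos_of_nonneg_of_nonpos (hp0 j) (hs1 j)] at hz1
  have hd1 : ∀ j, p j = 0 ∨ τ j = a := fun j => by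
    rcases mul_eq_zero.1 (hz1 j (Finset.mem_univ j)) with h | h
    · exact Or.inl h
    · right
      have := abs_le.1 (hτ j)
      have := (Real.sin_eq_zero_iff_of_lt_of_lt (by linarith) (by linarith)).1 h
      linarith
  have hd2 : ∀ j, q j = 0 ∨ τ j = -a := fun j => by
    rcases mul_eq_zero.1 (hz2 j (Finset.mem_univ j)) with h | h
    · exact Or.inl h
    · right
      have := abs_le.1 (hτ j)
      have := (Real.sin_eq_zero_iff_of_lt_of_lt (by linarith) (by linarith)).1 h
      linarith
  have h1 : (U * E)ᴴ * A₁ = Complex.exp (-a * Complex.I) • A₁ := by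
    rw [hW]; exact conjTranspose_mul_eq_smul hV hd1
  have h2 : (U * E)ᴴ * A₂ = Complex.exp (a * Complex.I) • A₂ := by
    rw [hW]
    have := conjTranspose_mul_eq_smul hV hd2
    simpa using this
  have hdiag : ∀ i, (A₁ * A₁ᴴ) i i = (A₂ * A₂ᴴ) i i := fun i => by
    have e1 : A₁ * A₁ᴴ * (U * E) = Complex.exp (a * Complex.I) • (A₁ * A₁ᴴ) := by
      have := congrArg conjTranspose h1
      rw [conjTranspose_mul, conjTranspose_conjTranspose, conjTranspose_smul, Complex.star_def,
        ← Complex.exp_conj] at this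
      rw [Matrix.mul_assoc, this, Matrix.mul_smul]
      simp
    have e2 : A₂ * A₂ᴴ * (U * E) = Complex.exp (-a * Complex.I) • (A₂ * A₂ᴴ) := by
      have := congrArg conjTranspose h2
      rw [conjTranspose_mul, conjTranspose_conjTranspose, conjTranspose_smul, Complex.star_def,
        ← Complex.exp_conj] at this
      rw [Matrix.mul_assoc, this, Matrix.mul_smul]
      simp
    have := hbE i
    rw [e1, e2, Matrix.smul_apply, Matrix.smul_apply, smul_eq_mul, smul_eq_mul, ← mul_assoc,
      ← mul_assoc, ← Complex.exp_add, ← Complex.exp_add] at this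
    simpa using this
  have ht2 : (A₁ * A₁ᴴ).trace = (A₂ * A₂ᴴ).trace := Finset.sum_congr rfl fun i _ => hdiag i
  have hsq : ((√2 : ℝ) : ℂ) * ((√2 : ℝ) : ℂ) = 2 := by
    rw [← Complex.ofReal_mul, Real.mul_self_sqrt (by norm_num)]; norm_num
  have hsm : ∀ A : Matrix n n ℂ, (((√2 : ℝ) : ℂ) • A) * (((√2 : ℝ) : ℂ) • A)ᴴ =
      (2 : ℂ) • (A * Aᴴ) := fun A => by
    rw [conjTranspose_smul, Complex.star_def, Complex.conj_ofReal, Matrix.smul_mul,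
      Matrix.mul_smul, smul_smul, hsq]
  -- The two states have equal traces, of sum `1`.
  refine ⟨((√2 : ℝ) : ℂ) • A₁, ((√2 : ℝ) : ℂ) • A₂, ?_, ?_, ?_, fun i => ?_⟩
  · rw [Matrix.mul_smul, h1, smul_comm]
  · rw [Matrix.mul_smul, h2, smul_comm]
  · rw [hsm, trace_smul, smul_eq_mul, two_mul]
    nth_rewrite 2 [ht2]
    exact ht
  · rw [hsm, hsm, Matrix.smul_apply, Matrix.smul_apply, hdiag i]

end Extremal

/-! ### Tensor products of matrices -/

section Tensor

variable {n : Type*} [Fintype n] [DecidableEq n] {N : ℕ}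

/-- The tensor product `M₀ ⊗ ⋯ ⊗ M_{N-1}`, with the index conventions of `tensorPow`. -/
def tensorFamily {n : Type*} {N : ℕ} (M : Fin N → Matrix n n ℂ) :
    Matrix (Fin N → n) (Fin N → n) ℂ :=
  Matrix.of fun i j => ∏ k, M k (i k) (j k)

lemma tensorPow_eq_tensorFamily (U : Matrix n n ℂ) :
    tensorPow U N = tensorFamily fun _ => U := rfl

lemma tensorFamily_mul (A B : Fin N → Matrix n n ℂ) :
    tensorFamily A * tensorFamily B = tensorFamily fun k => A k * B k := by
  ext i j
  simp only [Matrix.mul_apply, tensorFamily, of_apply, Finset.prod_univ_sum,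
    Fintype.piFinset_univ, Finset.prod_mul_distrib]

lemma conjTranspose_tensorFamily (A : Fin N → Matrix n n ℂ) :
    (tensorFamily A)ᴴ = tensorFamily fun k => (A k)ᴴ := by
  ext i j
  simp [tensorFamily, conjTranspose_apply]

lemma trace_tensorFamily (A : Fin N → Matrix n n ℂ) :
    (tensorFamily A).trace = ∏ k, (A k).trace := by
  simp only [Matrix.trace, diag_apply, tensorFamily, of_apply, Finset.prod_univ_sum,
    Fintype.piFinset_univ]

lemma tensorFamily_diagonal (w : Fin N → n → ℂ) :
    tensorFamily (fun k => diagonal (w k)) = diagonal fun i => ∏ k, w k (i k) := by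
  ext i j
  simp only [tensorFamily, of_apply]
  by_cases h : i = j
  · subst h; simp
  · rw [diagonal_apply_ne _ h]
    obtain ⟨k, hk⟩ := Function.ne_iff.1 h
    exact Finset.prod_eq_zero (Finset.mem_univ k) (diagonal_apply_ne _ hk)

lemma tensorPow_smul (c : ℂ) (A : Matrix n n ℂ) :
    tensorPow (c • A) N = c ^ N • tensorPow A N := by
  ext i j
  simp [tensorPow, Finset.prod_mul_distrib]

lemma tensorPow_one : tensorPow (1 : Matrix n n ℂ) N = 1 := by
  rw [tensorPow_eq_tensorFamily, ← diagonal_one, tensorFamily_diagonal]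
  simp

lemma tensorPow_mul (A B : Matrix n n ℂ) :
    tensorPow (A * B) N = tensorPow A N * tensorPow B N :=
  (tensorFamily_mul _ _).symm

lemma conjTranspose_tensorPow (A : Matrix n n ℂ) : (tensorPow A N)ᴴ = tensorPow Aᴴ N :=
  conjTranspose_tensorFamily _

lemma tensorPow_mem_unitaryGroup {U : Matrix n n ℂ} (hU : U ∈ unitaryGroup n ℂ) :
    tensorPow U N ∈ unitaryGroup (Fin N → n) ℂ := by
  rw [mem_unitaryGroup_iff, star_eq_conjTranspose, conjTranspose_tensorPow, ← tensorPow_mul,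
    ← star_eq_conjTranspose, mem_unitaryGroup_iff.1 hU, tensorPow_one]

lemma tensorPow_mem_diagonalUnitaries {E : Matrix n n ℂ} (hE : E ∈ diagonalUnitaries n) :
    tensorPow E N ∈ diagonalUnitaries (Fin N → n) := by
  refine ⟨tensorPow_mem_unitaryGroup hE.1, ?_⟩
  rw [← hE.2.diagonal_diag, tensorPow_eq_tensorFamily, tensorFamily_diagonal]
  exact isDiag_diagonal _

lemma posSemidef_tensorFamily {M : Fin N → Matrix n n ℂ} (h : ∀ k, (M k).PosSemidef) :
    (tensorFamily M).PosSemidef := by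
  choose A hA using fun k => exists_eq_mul_conjTranspose (h k)
  rw [show M = fun k => A k * (A k)ᴴ from funext hA, ← tensorFamily_mul,
    ← conjTranspose_tensorFamily]
  exact posSemidef_self_mul_conjTranspose _

/-- A chord bounds the distance of its arc from the midpoint of the chord. -/
lemma norm_exp_sub_cos_le {b s : ℝ} (hb : b ≤ Real.pi / 2) (hs : |s| ≤ b) :
    ‖Complex.exp (s * Complex.I) - (Real.cos b : ℂ)‖ ≤ Real.sin b := by
  have hb0 : 0 ≤ b := (abs_nonneg s).trans hs
  have hcb : 0 ≤ Real.cos b := Real.cos_nonneg_of_mem_Icc ⟨by linarith [Real.pi_pos], hb⟩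
  have hsb : 0 ≤ Real.sin b := Real.sin_nonneg_of_nonneg_of_le_pi hb0 (by linarith [Real.pi_pos])
  have hc : Real.cos b ≤ Real.cos s := by
    rw [← Real.cos_abs s]
    exact Real.cos_le_cos_of_nonneg_of_le_pi (abs_nonneg s) (by linarith [Real.pi_pos]) hs
  refine le_of_sq_le_sq ?_ hsb
  rw [← Complex.normSq_eq_norm_sq, Complex.normSq_apply, Complex.sub_re, Complex.sub_im,
    Complex.ofReal_re, Complex.ofReal_im, Complex.exp_ofReal_mul_I_re,
    Complex.exp_ofReal_mul_I_im]
  nlinarith [Real.sin_sq_add_cos_sq s, Real.sin_sq_add_cos_sq b, mul_nonneg hcb (sub_nonneg.2 hc)]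

lemma norm_tensorPow_sub_cos_le {V : Matrix n n ℂ} (hV : V ∈ unitaryGroup n ℂ) {τ : n → ℝ}
    {a : ℝ} (hN : N * a ≤ Real.pi / 2) (hτ : ∀ j, |τ j| ≤ a) (ha : 0 ≤ a) :
    ‖tensorPow (V * diagonal (fun j => Complex.exp (τ j * Complex.I)) * Vᴴ) N -
      (Real.cos (N * a) : ℂ) • 1‖ ≤ Real.sin (N * a) := by
  have hVN := tensorPow_mem_unitaryGroup (N := N) hV
  have hna : 0 ≤ N * a := by positivity
  have h1 : tensorPow (V * diagonal (fun j => Complex.exp (τ j * Complex.I)) * Vᴴ) N -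
      (Real.cos (N * a) : ℂ) • 1 = tensorPow V N * diagonal (fun i : Fin N → n =>
        Complex.exp ((∑ k, τ (i k) : ℝ) * Complex.I) - (Real.cos (N * a) : ℂ)) *
          (tensorPow V N)ᴴ := by
    rw [← diagonal_sub (fun i : Fin N → n => Complex.exp ((∑ k, τ (i k) : ℝ) * Complex.I))
      (fun _ => (Real.cos (N * a) : ℂ)), Matrix.mul_sub,
      Matrix.sub_mul, ← smul_one_eq_diagonal, Matrix.mul_smul, Matrix.smul_mul, Matrix.mul_one,
      ← star_eq_conjTranspose (tensorPow V N), mem_unitaryGroup_iff.1 hVN, star_eq_conjTranspose,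
      tensorPow_mul, tensorPow_mul, conjTranspose_tensorPow]
    congr 3
    rw [tensorPow_eq_tensorFamily, tensorFamily_diagonal]
    congr 1
    funext i
    rw [← Complex.exp_sum, ← Finset.sum_mul]
    push_cast
    rfl
  rw [h1]
  have hn := norm_le_one_of_mem_unitaryGroup hVN
  have hsb : 0 ≤ Real.sin (N * a) :=
    Real.sin_nonneg_of_nonneg_of_le_pi hna (by linarith [Real.pi_pos])
  have h2 : ‖fun i : Fin N → n => Complex.exp ((∑ k, τ (i k) : ℝ) * Complex.I) -
      (Real.cos (N * a) : ℂ)‖ ≤ Real.sin (N * a) := by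
    refine (pi_norm_le_iff_of_nonneg hsb).2 fun i => norm_exp_sub_cos_le hN ?_
    refine (Finset.abs_sum_le_sum_abs _ _).trans ((Finset.sum_le_sum fun k _ => hτ (i k)).trans ?_)
    simp
  refine (l2_opNorm_mul _ _).trans ((mul_le_of_le_one_right (norm_nonneg _) ?_).trans
    ((l2_opNorm_mul _ _).trans ((mul_le_of_le_one_left (norm_nonneg _) hn).trans ?_)))
  · rwa [l2_opNorm_conjTranspose]
  · rwa [l2_opNorm_diagonal]

end Tensor

/-! ### Perfect discrimination when `N Υ(U) ≥ π` -/

section Perfect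

variable {n : Type*} [Fintype n] [DecidableEq n] {N : ℕ}

/-- Steps of angle `θ ≤ π` that go at least half way around the circle surround the origin. -/
lemma exists_nonneg_sum_exp_eq_zero {θ : ℝ} (h0 : 0 < θ) (hπ : θ ≤ Real.pi)
    (hN : Real.pi ≤ N * θ) : ∃ c : ℕ → ℝ, (∀ k, 0 ≤ c k) ∧
      (∃ k ∈ Finset.range (N + 1), 0 < c k) ∧
      ∑ k ∈ Finset.range (N + 1), (c k : ℂ) * Complex.exp ((k * θ : ℝ) * Complex.I) = 0 := by
  have hsum : ∀ (x y z : ℝ) (p q : ℕ), p ≤ N → q ≤ N →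
      ∑ k ∈ Finset.range (N + 1), (((if k = 0 then x else 0) + (if k = p then y else 0) +
        (if k = q then z else 0) : ℝ) : ℂ) * Complex.exp ((k * θ : ℝ) * Complex.I) =
      x + y * Complex.exp ((p * θ : ℝ) * Complex.I) +
        z * Complex.exp ((q * θ : ℝ) * Complex.I) := fun x y z p q hp hq => by
    simp only [Complex.ofReal_add, apply_ite Complex.ofReal, Complex.ofReal_zero, add_mul,
      ite_mul, zero_mul, Finset.sum_add_distrib, Finset.sum_ite_eq', Finset.mem_range]
    rw [if_pos (by omega), if_pos (by omega), if_pos (by omega)]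
    simp
  obtain ⟨m, hm1, hm2, hmN⟩ : ∃ m : ℕ, m * θ < Real.pi ∧ Real.pi ≤ (m + 1 : ℕ) * θ ∧
      m + 1 ≤ N := by
    classical
    have hex : ∃ m : ℕ, Real.pi ≤ m * θ := ⟨N, hN⟩
    have hpos : Nat.find hex ≠ 0 := fun h => by
      have := Nat.find_spec hex
      rw [h] at this
      simp only [Nat.cast_zero, zero_mul] at this
      linarith [Real.pi_pos]
    obtain ⟨m, hm⟩ := Nat.exists_eq_succ_of_ne_zero hpos
    refine ⟨m, not_le.1 (Nat.find_min hex (by omega)), ?_, ?_⟩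
    · have := Nat.find_spec hex
      rwa [hm] at this
    · have := Nat.find_min' hex hN
      omega
  rcases Nat.eq_zero_or_pos m with rfl | hm
  · -- A single step reaches `-1`.
    have hθ : θ = Real.pi := le_antisymm hπ (by simpa using hm2)
    refine ⟨fun k => (if k = 0 then 1 else 0) + (if k = 1 then 1 else 0) +
      (if k = 0 then 0 else 0), fun k => by positivity, ⟨0, by simp, by simp⟩, ?_⟩
    rw [hsum 1 1 0 1 0 hmN (Nat.zero_le _), hθ]
    simp
  · -- The origin lies in the triangle spanned by `1` and the two steps around `-1`.
    have hmθ : 0 < m * θ := by positivity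
    push_cast at hm2
    have hs1 : 0 < Real.sin (m * θ) := Real.sin_pos_of_pos_of_lt_pi hmθ hm1
    have hs2 : 0 ≤ -Real.sin ((m + 1) * θ) := by
      have := Real.sin_nonneg_of_nonneg_of_le_pi (x := (m + 1) * θ - Real.pi) (by linarith)
        (by linarith)
      rwa [Real.sin_sub_pi] at this
    have hs3 : 0 ≤ Real.sin θ := Real.sin_nonneg_of_nonneg_of_le_pi h0.le hπ
    refine ⟨fun k => (if k = 0 then Real.sin θ else 0) +
      (if k = m then -Real.sin ((m + 1) * θ) else 0) +
      (if k = m + 1 then Real.sin (m * θ) else 0), fun k => ?_, ⟨m + 1, ?_, ?_⟩, ?_⟩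
    · refine add_nonneg (add_nonneg ?_ ?_) ?_ <;> split_ifs <;> first | assumption | exact le_rfl |
        exact hs1.le
    · simp; omega
    · simp [hs1]
    · rw [hsum _ _ _ m (m + 1) (by omega) hmN]
      have e : θ = (m + 1) * θ - m * θ := by ring
      have e2 : Real.sin θ = Real.sin ((m + 1) * θ) * Real.cos (m * θ) -
          Real.cos ((m + 1) * θ) * Real.sin (m * θ) := by
        rw [← Real.sin_sub, ← e]
      apply Complex.ext
      · simp only [Complex.add_re, Complex.ofReal_re, Complex.re_ofReal_mul,
          Complex.exp_ofReal_mul_I_re, Complex.zero_re]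
        push_cast
        rw [e2]
        ring
      · simp only [Complex.add_im, Complex.ofReal_im, Complex.im_ofReal_mul,
          Complex.exp_ofReal_mul_I_im, Complex.zero_im]
        push_cast
        ring

lemma exists_state_of_posSemidef {m : Type*} [Fintype m] [DecidableEq m] {σ W : Matrix m m ℂ}
    (hσ : σ.PosSemidef) (ht : σ.trace ≠ 0) (hd : ∀ i, (σ * W) i i = 0) :
    ∃ ρ : Matrix m m ℂ, ρ.PosSemidef ∧ ρ.trace = 1 ∧ ∀ i, (ρ * W) i i = 0 := by
  obtain ⟨A, rfl⟩ := exists_eq_mul_conjTranspose hσ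
  have h : (A * Aᴴ).trace = ((∑ i, ∑ k, ‖A i k‖ ^ 2 : ℝ) : ℂ) := by
    simp only [Matrix.trace, diag_apply, mul_conjTranspose_self_diag]
    push_cast
    rfl
  rw [h] at ht
  set r : ℝ := ∑ i, ∑ k, ‖A i k‖ ^ 2 with hr
  have hr0 : 0 ≤ r := by positivity
  refine ⟨r⁻¹ • (A * Aᴴ), hσ.smul (inv_nonneg.2 hr0), ?_, fun i => ?_⟩
  · rw [trace_smul, h, Complex.real_smul, Complex.ofReal_inv, inv_mul_cancel₀ ht]
  · rw [Matrix.smul_mul, Matrix.smul_apply, hd i, smul_zero]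

lemma tensorFamily_mul_tensorPow_diag (M : Fin N → Matrix n n ℂ) (U : Matrix n n ℂ)
    (i : Fin N → n) : (tensorFamily M * tensorPow U N) i i = ∏ k, (M k * U) (i k) (i k) := by
  rw [tensorPow_eq_tensorFamily, tensorFamily_mul]
  rfl

lemma exists_state_tensorPow_of_diag_eq_zero {U ρ : Matrix n n ℂ} (hN : N ≠ 0) (hρ : ρ.PosSemidef)
    (ht : ρ.trace ≠ 0) (hd : ∀ j, (ρ * U) j j = 0) :
    ∃ σ : Matrix (Fin N → n) (Fin N → n) ℂ, σ.PosSemidef ∧ σ.trace = 1 ∧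
      ∀ i, (σ * tensorPow U N) i i = 0 := by
  refine exists_state_of_posSemidef (posSemidef_tensorFamily fun _ : Fin N => hρ) ?_ fun i => ?_
  · rw [trace_tensorFamily]
    exact Finset.prod_ne_zero_iff.2 fun _ _ => ht
  · rw [tensorFamily_mul_tensorPow_diag]
    exact Finset.prod_eq_zero (Finset.mem_univ ⟨0, Nat.pos_of_ne_zero hN⟩) (hd _)

/-- The states `ρ₁^{⊗ k} ⊗ ρ₂^{⊗ (N - k)}` of a balanced pair contribute to the diagonal of
`ρ U^{⊗ N}` with the phases `exp (i k θ)`, and a mixture of them makes it vanish. -/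
lemma exists_state_diag_mul_tensorPow_eq_zero [Nonempty n] {U : Matrix n n ℂ}
    (hU : U ∈ unitaryGroup n ℂ) (hN : Real.pi ≤ N * optimalArcAngle U) :
    ∃ ρ : Matrix (Fin N → n) (Fin N → n) ℂ, ρ.PosSemidef ∧ ρ.trace = 1 ∧
      ∀ i, (ρ * tensorPow U N) i i = 0 := by
  have hN0 : N ≠ 0 := by
    rintro rfl
    simp only [Nat.cast_zero, zero_mul] at hN
    linarith [Real.pi_pos]
  have hΥ : 0 < optimalArcAngle U := by
    rcases (optimalArcAngle_nonneg hU).lt_or_eq with h | h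
    · exact h
    · rw [← h, mul_zero] at hN
      linarith [Real.pi_pos]
  set θ := min (optimalArcAngle U) Real.pi with hθ
  have hθ0 : 0 < θ := lt_min hΥ Real.pi_pos
  have hθπ : θ ≤ Real.pi := min_le_right _ _
  have hNθ : Real.pi ≤ N * θ := by
    rw [hθ]
    rcases min_choice (optimalArcAngle U) Real.pi with h | h <;> rw [h]
    · exact hN
    · have : (1 : ℝ) ≤ N := by exact_mod_cast Nat.one_le_iff_ne_zero.2 hN0
      nlinarith [Real.pi_pos]
  obtain ⟨⟨ρ₁, ρ₂⟩, ⟨hρ₁, hρ₂, ht⟩, hb⟩ := exists_balanced_statePair hU (a := θ / 2)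
    (by linarith) (by linarith) (by linarith [min_le_left (optimalArcAngle U) Real.pi])
  simp only at hρ₁ hρ₂ ht hb
  set z := Complex.exp (θ * Complex.I) with hz
  have hbz : ∀ j, (ρ₁ * U) j j = z * (ρ₂ * U) j j := fun j => by
    have h := congrArg (fun x => Complex.exp ((θ / 2 : ℝ) * Complex.I) * x) (hb j)
    simp only [← mul_assoc, ← Complex.exp_add] at h
    rw [show ((θ / 2 : ℝ) : ℂ) * Complex.I + -((θ / 2 : ℝ) : ℂ) * Complex.I = 0 by ring,
      show ((θ / 2 : ℝ) : ℂ) * Complex.I + ((θ / 2 : ℝ) : ℂ) * Complex.I = θ * Complex.I by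
        push_cast; ring, Complex.exp_zero, one_mul] at h
    exact h
  by_cases h1 : ρ₁.trace = 0
  · have : ρ₁ = 0 := hρ₁.trace_eq_zero_iff.1 h1
    refine exists_state_tensorPow_of_diag_eq_zero hN0 hρ₂ (by simp [h1] at ht; simp [ht]) fun j => ?_
    have h := hbz j
    rw [this, Matrix.zero_mul, Matrix.zero_apply, eq_comm, mul_eq_zero] at h
    exact h.resolve_left (Complex.exp_ne_zero _)
  by_cases h2 : ρ₂.trace = 0
  · have : ρ₂ = 0 := hρ₂.trace_eq_zero_iff.1 h2
    refine exists_state_tensorPow_of_diag_eq_zero hN0 hρ₁ h1 fun j => ?_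
    rw [hbz j, this, Matrix.zero_mul, Matrix.zero_apply, mul_zero]
  have ht1 : 0 < ρ₁.trace := lt_of_le_of_ne hρ₁.trace_nonneg (Ne.symm h1)
  have ht2 : 0 < ρ₂.trace := lt_of_le_of_ne hρ₂.trace_nonneg (Ne.symm h2)
  obtain ⟨c, hc0, ⟨k₀, hk₀, hck₀⟩, hc⟩ := exists_nonneg_sum_exp_eq_zero hθ0 hθπ hNθ
  set M : ℕ → Fin N → Matrix n n ℂ := fun k l => if (l : ℕ) < k then ρ₁ else ρ₂ with hM
  have hMp : ∀ k l, (M k l).PosSemidef := fun k l => by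
    simp only [hM]
    split_ifs
    · exact hρ₁
    · exact hρ₂
  have hMt : ∀ k, 0 < (tensorFamily (M k)).trace := fun k => by
    rw [trace_tensorFamily]
    refine Finset.prod_pos fun l _ => ?_
    simp only [hM]
    split_ifs
    · exact ht1
    · exact ht2
  have hMd : ∀ k ∈ Finset.range (N + 1), ∀ i, (tensorFamily (M k) * tensorPow U N) i i =
      Complex.exp ((k * θ : ℝ) * Complex.I) * ∏ l, (ρ₂ * U) (i l) (i l) := fun k hk i => by
    have h : ∀ l : Fin N, (M k l * U) (i l) (i l) =
        (if (l : ℕ) < k then z else 1) * (ρ₂ * U) (i l) (i l) := fun l => by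
      simp only [hM]
      split_ifs
      · exact hbz _
      · rw [one_mul]
    rw [tensorFamily_mul_tensorPow_diag, Finset.prod_congr rfl fun l _ => h l,
      Finset.prod_mul_distrib]
    congr 1
    have hcard : (Finset.univ.filter fun l : Fin N => (l : ℕ) < k).card = k := by
      rw [Fin.card_filter_val_lt]
      rw [Finset.mem_range] at hk
      omega
    rw [Finset.prod_ite, Finset.prod_const_one, mul_one, Finset.prod_const, hcard, hz,
      ← Complex.exp_nat_mul]
    congr 1
    push_cast
    ring
  refine exists_state_of_posSemidef (σ := ∑ k ∈ Finset.range (N + 1), c k • tensorFamily (M k))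
    (posSemidef_sum _ fun k _ => (posSemidef_tensorFamily (hMp k)).smul (hc0 k)) ?_ fun i => ?_
  · rw [trace_sum]
    refine (Finset.sum_pos' (fun k _ => ?_) ⟨k₀, hk₀, ?_⟩).ne'
    · rw [trace_smul]
      exact smul_nonneg (hc0 k) (hMt k).le
    · rw [trace_smul]
      exact smul_pos hck₀ (hMt k₀)
  · rw [Finset.sum_mul, Matrix.sum_apply]
    rw [Finset.sum_congr rfl fun k hk => by
      rw [Matrix.smul_mul, Matrix.smul_apply, hMd k hk i, Complex.real_smul, ← mul_assoc],
      ← Finset.sum_mul, hc, zero_mul]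

end Perfect

/-! ### The diamond distance when `N Υ(U) < π` -/

section Sine

variable {n : Type*} [Fintype n] [DecidableEq n] {N : ℕ}

lemma exists_mem_diamondValues_nonneg {m : Type*} [Fintype m] [DecidableEq m] [Nonempty n]
    (S : Matrix n n ℂ →ₗ[ℂ] Matrix m m ℂ) : ∃ t ∈ diamondValues S, 0 ≤ t := by
  obtain ⟨p⟩ := (inferInstance : Nonempty (n × n))
  have h : ∑ q : n × n, ‖(Pi.single p 1 : n × n → ℂ) q‖ ^ 2 = 1 := by
    rw [Finset.sum_eq_single p]
    · simp
    · intro q _ hq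
      simp [hq]
    · simp
  exact ⟨_, ⟨_, traceNorm_vecMulVec h h, rfl⟩, traceNorm_nonneg _⟩

lemma isGreatest_diamondValues_sin [Nonempty n] {U : Matrix n n ℂ} (hU : U ∈ unitaryGroup n ℂ)
    (hN : N * optimalArcAngle U < Real.pi) :
    IsGreatest (diamondValues (vonNeumannChannel (tensorPow U N) - vonNeumannChannel 1))
      (2 * Real.sin (N * optimalArcAngle U / 2)) := by
  obtain ⟨E, hE, V, hV, τ, hW, hτ⟩ := exists_centered_diagonalization hU
  have hΥ := optimalArcAngle_nonneg hU
  set a := optimalArcAngle U / 2 with ha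
  have hNa : N * optimalArcAngle U / 2 = N * a := by rw [ha]; ring
  have hNa2 : N * a ≤ Real.pi / 2 := by rw [← hNa]; linarith
  have ha0 : 0 ≤ a := by rw [ha]; positivity
  have hNa0 : 0 ≤ N * a := by positivity
  have hs0 : 0 ≤ Real.sin (N * a) :=
    Real.sin_nonneg_of_nonneg_of_le_pi hNa0 (by linarith [Real.pi_pos])
  rw [hNa, ← vonNeumannChannel_mul_diagonalUnitary _ (tensorPow_mem_diagonalUnitaries (N := N) hE),
    ← tensorPow_mul]
  have hub : ∀ t ∈ diamondValues (vonNeumannChannel (tensorPow (U * E) N) - vonNeumannChannel 1),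
      t ≤ 2 * Real.sin (N * a) := by
    rintro t ⟨X, hX, rfl⟩
    refine (traceNorm_ampliation_sub_one_le (tensorPow_mem_unitaryGroup (mul_mem hU hE.1))
      (Real.cos (N * a) : ℂ) X).trans ?_
    rw [hX, mul_one, hW]
    linarith [norm_tensorPow_sub_cos_le hV hNa2 hτ ha0]
  have hlb : ∃ t ∈ diamondValues (vonNeumannChannel (tensorPow (U * E) N) - vonNeumannChannel 1),
      2 * Real.sin (N * a) ≤ t := by
    rcases hNa0.eq_or_lt with h0 | h0
    · rw [← h0, Real.sin_zero, mul_zero]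
      exact exists_mem_diamondValues_nonneg _
    · have hN0 : N ≠ 0 := by rintro rfl; simp at h0
      have hapos : 0 < a := pos_of_mul_pos_right h0 (Nat.cast_nonneg N)
      have ha2 : a < Real.pi / 2 := by
        have : (1 : ℝ) ≤ N := by exact_mod_cast Nat.one_le_iff_ne_zero.2 hN0
        have : N * a < Real.pi / 2 := by rw [← hNa]; linarith
        nlinarith
      obtain ⟨A₁, A₂, h1, h2, ht, hd⟩ := exists_extremal_eigenstates hU hE hV hW hapos ha2
        (by rw [ha]; linarith) hτ
      obtain ⟨t, ht, hle⟩ := exists_diamondValue_ge (W := tensorPow (U * E) N)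
        (A₁ := tensorPow A₁ N) (A₂ := tensorPow A₂ N)
        (x₁ := Complex.exp (-a * Complex.I) ^ N) (x₂ := Complex.exp (a * Complex.I) ^ N)
        (by rw [conjTranspose_tensorPow, ← tensorPow_mul, h1, tensorPow_smul])
        (by rw [conjTranspose_tensorPow, ← tensorPow_mul, h2, tensorPow_smul])
        (by
          rw [conjTranspose_tensorPow, ← tensorPow_mul, tensorPow_eq_tensorFamily,
            trace_tensorFamily, ht]
          simp)
        (fun i => by
          rw [conjTranspose_tensorPow, ← tensorPow_mul, conjTranspose_tensorPow, ← tensorPow_mul]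
          change ∏ k, (A₁ * A₁ᴴ) (i k) (i k) = ∏ k, (A₂ * A₂ᴴ) (i k) (i k)
          exact Finset.prod_congr rfl fun k _ => hd (i k))
      refine ⟨t, ht, le_trans (le_of_eq ?_) hle⟩
      have e : Complex.exp (-a * Complex.I) ^ N * star (Complex.exp (a * Complex.I) ^ N) =
          Complex.exp (Complex.I * (-(2 * (N * a)) : ℝ)) := by
        rw [star_pow, Complex.star_def, ← Complex.exp_conj, ← Complex.exp_nat_mul,
          ← Complex.exp_nat_mul, ← Complex.exp_add]
        congr 1
        simp
        ring
      rw [e, Complex.norm_exp_I_mul_ofReal_sub_one, Real.norm_eq_abs,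
        show -(2 * (N * a)) / 2 = -(N * a) by ring, Real.sin_neg, mul_neg, abs_neg,
        abs_of_nonneg (by positivity)]
  obtain ⟨t, ht, hle⟩ := hlb
  rw [le_antisymm hle (hub t ht)]
  exact ⟨ht, fun s hs => (hub s hs).trans hle⟩

/-- Measurements with different projectors differ by more than phases. -/
lemma optimalArcAngle_pos_of_vonNeumannProjectors_ne {U V : Matrix n n ℂ}
    (hU : U ∈ unitaryGroup n ℂ) (hV : V ∈ unitaryGroup n ℂ)
    (h : vonNeumannProjectors U ≠ vonNeumannProjectors V) : 0 < optimalArcAngle (Vᴴ * U) := by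
  have hVU : Vᴴ * U ∈ unitaryGroup n ℂ := mul_mem (Unitary.star_mem hV) hU
  refine (optimalArcAngle_nonneg hVU).lt_of_ne' fun h0 => h ?_
  have hdiag := isDiag_of_optimalArcAngle_eq_zero hVU h0
  obtain ⟨e, he⟩ : ∃ e, Vᴴ * U = diagonal e := ⟨_, hdiag.diagonal_diag.symm⟩
  have hUe : U = V * diagonal e := by
    rw [← he, ← Matrix.mul_assoc, ← star_eq_conjTranspose, mem_unitaryGroup_iff.1 hV,
      Matrix.one_mul]
  have hee : ∀ i, e i * star (e i) = 1 := fun i => by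
    have h1 := mem_unitaryGroup_iff.1 hVU
    rw [he, star_eq_conjTranspose, diagonal_conjTranspose, diagonal_mul_diagonal] at h1
    simpa using congrFun (congrFun h1 i) i
  funext i
  ext x y
  simp only [vonNeumannProjectors, vecMulVec_apply]
  rw [hUe, mul_diagonal, mul_diagonal, star_mul', mul_mul_mul_comm, hee i, mul_one]

lemma diamondNorm_eq_of_isGreatest {m : Type*} [Fintype m] [DecidableEq m]
    {S : Matrix n n ℂ →ₗ[ℂ] Matrix m m ℂ} {r : ℝ} (h : IsGreatest (diamondValues S) r) :
    diamondNorm S = r :=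
  h.csSup_eq

end Sine

end VonNeumannDiscrimination

open VonNeumannDiscrimination in
theorem mainTheorem2 (d : ℕ) (hd : 0 < d) :
    (∀ U ∈ Matrix.unitaryGroup (Fin d) ℂ,
      IsLeast (coveringArcLengths U) (arcAngle U) ∧
      IsLeast ((fun E => arcAngle (U * E)) '' diagonalUnitaries (Fin d)) (optimalArcAngle U) ∧
      ∀ N : ℕ,
        IsGreatest (diamondValues (vonNeumannChannel (tensorPow U N) - vonNeumannChannel 1))
          (diamondNorm (vonNeumannChannel (tensorPow U N) - vonNeumannChannel 1)) ∧
        (Real.pi ≤ (N : ℝ) * optimalArcAngle U →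
          diamondNorm (vonNeumannChannel (tensorPow U N) - vonNeumannChannel 1) = 2 ∧
          PerfectlyDiscriminable (vonNeumannChannel (tensorPow U N)) (vonNeumannChannel 1)) ∧
        ((N : ℝ) * optimalArcAngle U < Real.pi →
          diamondNorm (vonNeumannChannel (tensorPow U N) - vonNeumannChannel 1) =
            2 * Real.sin ((N : ℝ) * optimalArcAngle U / 2))) ∧
    (∀ U ∈ Matrix.unitaryGroup (Fin d) ℂ, ∀ V ∈ Matrix.unitaryGroup (Fin d) ℂ,
      vonNeumannProjectors U ≠ vonNeumannProjectors V →
      ∃ N : ℕ,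
        diamondNorm (vonNeumannChannel (tensorPow U N) - vonNeumannChannel (tensorPow V N)) = 2 ∧
        PerfectlyDiscriminable (vonNeumannChannel (tensorPow U N))
          (vonNeumannChannel (tensorPow V N))) := by
  have : Nonempty (Fin d) := ⟨⟨0, hd⟩⟩
  constructor
  · intro U hU
    refine ⟨isLeast_arcAngle hU, isLeast_optimalArcAngle hU, fun N => ?_⟩
    have hUN := tensorPow_mem_unitaryGroup (N := N) hU
    have hone := one_mem (Matrix.unitaryGroup (Fin N → Fin d) ℂ)
    rcases le_or_gt Real.pi (N * optimalArcAngle U) with h | h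
    · obtain ⟨ρ, hρ, ht, hdiag⟩ := exists_state_diag_mul_tensorPow_eq_zero hU h
      have hdiag' : ∀ i, ((1 : Matrix (Fin N → Fin d) (Fin N → Fin d) ℂ)ᴴ * ρ *
          tensorPow U N) i i = 0 := by simpa using hdiag
      have hg := isGreatest_diamondValues_two hUN hone hρ ht hdiag'
      rw [diamondNorm_eq_of_isGreatest hg]
      exact ⟨hg, fun _ => ⟨rfl, perfectlyDiscriminable_of_diag_eq_zero hUN hρ ht hdiag'⟩,
        fun h' => absurd h (not_le.2 h')⟩
    · have hg := isGreatest_diamondValues_sin hU h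
      rw [diamondNorm_eq_of_isGreatest hg]
      exact ⟨hg, fun h' => absurd h (not_lt.2 h'), fun _ => rfl⟩
  · intro U hU V hV hne
    have hpos := optimalArcAngle_pos_of_vonNeumannProjectors_ne hU hV hne
    obtain ⟨N, hN⟩ := exists_nat_ge (Real.pi / optimalArcAngle (Vᴴ * U))
    rw [div_le_iff₀ hpos] at hN
    obtain ⟨ρ, hρ, ht, hdiag⟩ :=
      exists_state_diag_mul_tensorPow_eq_zero (mul_mem (Unitary.star_mem hV) hU) hN
    have hUN := tensorPow_mem_unitaryGroup (N := N) hU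
    have hVN := tensorPow_mem_unitaryGroup (N := N) hV
    have hVV : (tensorPow V N)ᴴ * tensorPow V N = 1 := Matrix.mem_unitaryGroup_iff'.1 hVN
    -- The state for `Vᴴ U` against the standard basis, rotated by `V^{⊗ N}`.
    set σ := tensorPow V N * ρ * (tensorPow V N)ᴴ with hσ
    have hσp : σ.PosSemidef := hρ.mul_mul_conjTranspose_same _
    have hσt : σ.trace = 1 := by
      rw [hσ, Matrix.trace_mul_comm, ← Matrix.mul_assoc, hVV, Matrix.one_mul, ht]
    have hσd : ∀ i, ((tensorPow V N)ᴴ * σ * tensorPow U N) i i = 0 := fun i => by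
      have h : (tensorPow V N)ᴴ * σ * tensorPow U N = ρ * tensorPow (Vᴴ * U) N := by
        rw [hσ, ← Matrix.mul_assoc, ← Matrix.mul_assoc, hVV, Matrix.one_mul, Matrix.mul_assoc,
          conjTranspose_tensorPow, ← tensorPow_mul]
      rw [h]
      exact hdiag i
    exact ⟨N, diamondNorm_eq_of_isGreatest (isGreatest_diamondValues_two hUN hVN hσp hσt hσd),
      perfectlyDiscriminable_of_diag_eq_zero hUN hσp hσt hσd⟩
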